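/- Let $k\ge 1$ be an integer and $\rho>0$. For $\lambda\in\mathbb{R}$ let $\varphi_\lambda:[0,\infty)\to\mathbb{C}$ be the radial eigenfunction of the Laplacian of the $(k+1)$-dimensional hyperbolic space of constant sectional curvature $-1/\rho^2$ with $\varphi_\lambda(0)=1$, written as a function of the hyperbolic distance $r$ to the origin; that is, $\varphi_\lambda$ is the function that is continuous on $[0,\infty)$, of class $C^2$ on $(0,\infty)$, and satisfies $$\varphi_\lambda''(r)+\frac{k}{\rho}\coth\left(\frac r\rho\right)\varphi_\lambda'(r)+\lambda\varphi_\lambda(r)=0\quad(r>0),\qquad \varphi_\lambda(0)=1 .$$ Theorem. Fix $r>0$. As $\lambda\to+\infty$ the following hold. (A) If $k=1$, then $$\varphi_\lambda(r)=\sqrt{\frac{2}{\pi\rho\sinh(r/\rho)}}\cdot\frac{\cos(\pi/4-r\sqrt\lambda)}{\lambda^{1/4}}+o\left(\frac1{\lambda^{1/4}}\right).$$ (B) If $k=2$, then for every $\lambda>1/\rho^2$, with $b=\sqrt{\lambda\rho^2-1}$, $$\varphi_\lambda(r)=\frac{\sin(br/\rho)}{b\sinh(r/\rho)},$$ and $$\varphi_\lambda(r)=\frac{1}{\rho\sinh(r/\rho)}\cdot\frac{\sin(r\sqrt\lambda)}{\sqrt\lambda}+o\left(\frac1{\sqrt\lambda}\right).$$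 (C) If $k\ge3$, then $\varphi_\lambda(r)=o(1/\sqrt\lambda)$. (D) In particular, if $k=4$, then $$\varphi_\lambda(r)=-\left(\frac{\sqrt3}{\rho\sinh(r/\rho)}\right)^2\frac{\cos(r\sqrt\lambda)}{\lambda}+o\left(\frac1\lambda\right).$$ -/

import Mathlib

open Filter Asymptotics

noncomputable section

/-- The Laplacian of the `(k+1)`-dimensional hyperbolic space of constant sectional curvature
`-1/ρ²`, in geodesic polar coordinates and applied to a function `φ` of the distance `r > 0` to the
origin: `φ''(r) + (k/ρ) coth(r/ρ) φ'(r)`. -/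
def hyperbolicRadialLaplacian (k : ℕ) (ρ : ℝ) (φ : ℝ → ℂ) (r : ℝ) : ℂ :=
  deriv (deriv φ) r
    + (((k : ℝ) / ρ * (Real.cosh (r / ρ) / Real.sinh (r / ρ)) : ℝ) : ℂ) * deriv φ r

/-- `φ` is the radial eigenfunction `φ_lam` of the hyperbolic Laplacian: as a function of the
distance `r ∈ [0, ∞)` to the origin it is continuous, it is twice continuously differentiable on
`(0, ∞)`, it satisfies `Δφ + lam φ = 0` there, and `φ(0) = 1`. Values of `φ` at negative arguments
are irrelevant. -/
structure IsRadialEigenfunction (k : ℕ) (ρ : ℝ) (lam : ℂ) (φ : ℝ → ℂ) : Prop where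
  continuousOn : ContinuousOn φ (Set.Ici 0)
  contDiffOn : ContDiffOn ℝ 2 φ (Set.Ioi 0)
  eigen : ∀ r : ℝ, 0 < r → hyperbolicRadialLaplacian k ρ φ r + lam * φ r = 0
  map_zero : φ 0 = 1

end

open scoped Topology

/-! The substitution `t = r / ρ`, `Λ = lam * ρ ^ 2` reduces everything to curvature `-1`. There
`(sinh ^ k * f')' = -Λ * sinh ^ k * f`. Continuity of `f` at the origin already forces `f' → 0`
there, which excludes the singular solutions. The energy `f' ^ 2 + Λ * f ^ 2` is nonincreasing,
since its derivative is `-2k coth t * f' ^ 2`. Hence `|f| ≤ |f(0)|`, so a solution is determined by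
its value at the origin (`IsRadialSolution.eq`), and any explicit solution with value `1` there is
the eigenfunction.

For `k = 2` the solution is `sin (b t) / (b sinh t)` with `Λ = 1 + b ^ 2`. For `k = 4` it is a
multiple of `(1 / sinh t) d/dt` of that function, with `Λ = 4 + b ^ 2`. The asymptotics follow
because `√Λ - √(Λ - c) → 0`.

For `k ≥ 3` no formula is needed: `w = sinh ^ (k / 2) * f` satisfies `w'' + p w = 0` with `p`
nondecreasing, so `w' ^ 2 / p + w ^ 2` is nonincreasing where `p > 0`. Starting it at distance of
order `k / √Λ`, where the first energy controls `f` and `f'`, gives `f = O(Λ ^ (-k / 4))`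
(`sinh_pow_mul_sq_le`).

For `k = 1` the solution is the mean over directions of the plane wave `horo ^ (-1 / 2 + i b)`, with
`Λ = 1 / 4 + b ^ 2` (`isRadialSolution_one`). Taking the logarithm of `horo` as variable gives the
Mehler–Dirichlet integral (`integral_planeWave_re`). Its inverse square root singularity at the
endpoint `s = t` yields the leading term through the Fresnel integral
(`tendsto_sqrt_mul_integral_cexp_div_sqrt`). -/

/-! ### The radial equation near the origin: energy bound and uniqueness. -/

theorem tendsto_const_mul_nhdsGT_zero {c : ℝ} (hc : 0 < c) :
    Tendsto (fun x : ℝ => c * x) (𝓝[>] 0) (𝓝[>] 0) := by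
  refine tendsto_nhdsWithin_iff.2 ⟨?_, ?_⟩
  · have : Tendsto (fun x : ℝ => c * x) (𝓝 0) (𝓝 (c * 0)) :=
      (continuous_const.mul continuous_id).tendsto 0
    rw [mul_zero] at this
    exact this.mono_left nhdsWithin_le_nhds
  · filter_upwards [self_mem_nhdsWithin] with x hx
    exact mul_pos hc hx

/-- `f` is a real solution on `(0, ∞)`, with derivative `f'`, of the radial eigenvalue equation in
curvature `-1`, and `f` tends to `a` at the origin. -/
structure IsRadialSolution (k : ℕ) (Λ : ℝ) (f f' : ℝ → ℝ) (a : ℝ) : Prop where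
  hasDerivAt : ∀ t : ℝ, 0 < t → HasDerivAt f (f' t) t
  hasDerivAt' : ∀ t : ℝ, 0 < t →
    HasDerivAt f' (-(k * (Real.cosh t / Real.sinh t)) * f' t - Λ * f t) t
  tendsto : Tendsto f (𝓝[>] 0) (𝓝 a)

namespace IsRadialSolution

variable {k : ℕ} {Λ : ℝ} {f f' g g' : ℝ → ℝ} {a b : ℝ}

theorem sub (hf : IsRadialSolution k Λ f f' a) (hg : IsRadialSolution k Λ g g' b) :
    IsRadialSolution k Λ (fun t => f t - g t) (fun t => f' t - g' t) (a - b) where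
  hasDerivAt t ht := (hf.hasDerivAt t ht).sub (hg.hasDerivAt t ht)
  hasDerivAt' t ht :=
    ((hf.hasDerivAt' t ht).sub (hg.hasDerivAt' t ht)).congr_deriv (by ring)
  tendsto := hf.tendsto.sub hg.tendsto

theorem hasDerivAt_sinh_pow_mul (hf : IsRadialSolution k Λ f f' a) {t : ℝ} (ht : 0 < t) :
    HasDerivAt (fun x => Real.sinh x ^ k * f' x) (-Λ * Real.sinh t ^ k * f t) t := by
  have hs : Real.sinh t ≠ 0 := (Real.sinh_pos_iff.2 ht).ne'
  refine (((Real.hasDerivAt_sinh t).pow k).mul (hf.hasDerivAt' t ht)).congr_deriv ?_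
  rcases Nat.eq_zero_or_pos k with rfl | hk
  · simp
  · obtain ⟨m, rfl⟩ : ∃ m, k = m + 1 := ⟨k - 1, by omega⟩
    simp only [Nat.add_sub_cancel, pow_succ, Pi.pow_apply]
    field_simp
    ring

/-- By the mean value theorem on `[x, 2x]`, `f' ξ = (f (2x) - f x) / x`. The numerator tends to `0`
because `f` has a limit, while `sinh (2x) / x` stays bounded. Since `k ≥ 1`, `sinh ξ ^ k ≤ sinh
(2x)` as soon as `sinh (2x) < 1`. -/
theorem exists_sinh_pow_mul_lt (hf : IsRadialSolution k Λ f f' a) (hk : 1 ≤ k) {s ε : ℝ}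
    (hs : 0 < s) (hε : 0 < ε) : ∃ ξ, 0 < ξ ∧ ξ < s ∧ |Real.sinh ξ ^ k * f' ξ| < ε := by
  have h2 := tendsto_const_mul_nhdsGT_zero (zero_lt_two' ℝ)
  have hsl : Tendsto (fun x : ℝ => Real.sinh (2 * x) / x) (𝓝[>] 0) (𝓝 2) := by
    have hd : HasDerivAt (fun x : ℝ => Real.sinh (2 * x)) 2 0 := by
      have := ((hasDerivAt_id (0 : ℝ)).const_mul 2).sinh
      simpa using this
    have := (hasDerivAt_iff_tendsto_slope.1 hd).mono_left
      (nhdsWithin_mono (0 : ℝ) (fun x (hx : 0 < x) => hx.ne'))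
    refine this.congr fun x => ?_
    simp [slope_def_field]
  have hz : Tendsto (fun x : ℝ => Real.sinh (2 * x) / x * |f (2 * x) - f x|) (𝓝[>] 0) (𝓝 0) := by
    have := hsl.mul ((hf.tendsto.comp h2).sub hf.tendsto).abs
    simpa using this
  have h1 : Tendsto (fun x : ℝ => Real.sinh (2 * x)) (𝓝[>] 0) (𝓝 0) := by
    have : Tendsto (fun x : ℝ => Real.sinh x) (𝓝 0) (𝓝 (Real.sinh 0)) :=
      Real.continuous_sinh.tendsto 0
    rw [Real.sinh_zero] at this
    exact (this.mono_left nhdsWithin_le_nhds).comp h2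
  have hid : Tendsto (fun x : ℝ => 2 * x) (𝓝[>] 0) (𝓝 0) := h2.mono_right nhdsWithin_le_nhds
  obtain ⟨x, hx1, hx2, hx3, hx0⟩ := ((hz.eventually (gt_mem_nhds hε)).and
    ((h1.eventually (gt_mem_nhds one_pos)).and
    ((hid.eventually (gt_mem_nhds hs)).and self_mem_nhdsWithin))).exists
  have hx0 : 0 < x := hx0
  obtain ⟨ξ, ⟨hξ1, hξ2⟩, hξ⟩ := exists_hasDerivAt_eq_slope f f' (show x < 2 * x by linarith)
    (fun y hy => (hf.hasDerivAt y (hx0.trans_le hy.1)).continuousAt.continuousWithinAt)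
    (fun y hy => hf.hasDerivAt y (hx0.trans hy.1))
  have hξ0 : 0 < ξ := hx0.trans hξ1
  refine ⟨ξ, hξ0, hξ2.trans hx3, ?_⟩
  have hsξ : 0 < Real.sinh ξ := Real.sinh_pos_iff.2 hξ0
  have hle : Real.sinh ξ ≤ Real.sinh (2 * x) := Real.sinh_le_sinh.2 hξ2.le
  have hp : Real.sinh ξ ^ k ≤ Real.sinh (2 * x) :=
    (pow_le_of_le_one hsξ.le (hle.trans hx2.le) (by omega)).trans hle
  rw [abs_mul, abs_of_pos (pow_pos hsξ k), hξ, abs_div, show 2 * x - x = x by ring,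
    abs_of_pos hx0]
  calc _ ≤ Real.sinh (2 * x) * (|f (2 * x) - f x| / x) := by gcongr
    _ = Real.sinh (2 * x) / x * |f (2 * x) - f x| := by ring
    _ < ε := hx1

/-- Integrate `(sinh ^ k * f')' = -Λ * sinh ^ k * f` from a point `ξ` near `0`, where the boundary
term is below any `ε`. As `sinh` increases, the weight is at most `sinh s ^ k`, which then cancels.
-/
theorem abs_deriv_le (hf : IsRadialSolution k Λ f f' a) (hk : 1 ≤ k) (hΛ : 0 ≤ Λ) {s M : ℝ}
    (hs : 0 < s) (hM : ∀ x, 0 < x → x ≤ s → |f x| ≤ M) : |f' s| ≤ Λ * M * s := by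
  have hss : 0 < Real.sinh s ^ k := pow_pos (Real.sinh_pos_iff.2 hs) k
  have hM0 : 0 ≤ M := (abs_nonneg _).trans (hM s hs le_rfl)
  refine le_of_mul_le_mul_left ?_ hss
  refine le_of_forall_pos_le_add fun ε hε => ?_
  obtain ⟨ξ, hξ0, hξs, hξ⟩ := hf.exists_sinh_pow_mul_lt hk hs hε
  have key := (convex_Icc ξ s).norm_image_sub_le_of_norm_hasDerivWithin_le
    (f := fun x => Real.sinh x ^ k * f' x) (f' := fun t => -Λ * Real.sinh t ^ k * f t)
    (C := Λ * Real.sinh s ^ k * M) (x := ξ) (y := s)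
    (fun x hx => (hf.hasDerivAt_sinh_pow_mul (hξ0.trans_le hx.1)).hasDerivWithinAt)
    (fun x hx => by
      have hx0 := hξ0.trans_le hx.1
      have h0 := Real.sinh_pos_iff.2 hx0
      have h1 : Real.sinh x ≤ Real.sinh s := Real.sinh_le_sinh.2 hx.2
      rw [Real.norm_eq_abs, abs_mul, abs_mul, abs_neg, abs_of_nonneg hΛ,
        abs_of_pos (pow_pos h0 k)]
      have := hM x hx0 hx.2
      gcongr)
    (Set.left_mem_Icc.2 hξs.le) (Set.right_mem_Icc.2 hξs.le)
  simp only [Real.norm_eq_abs] at key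
  rw [abs_of_pos (sub_pos.2 hξs)] at key
  have h3 : Real.sinh s ^ k * |f' s| = |Real.sinh s ^ k * f' s| := by
    rw [abs_mul, abs_of_pos hss]
  have h4 : |Real.sinh s ^ k * f' s| ≤ |Real.sinh s ^ k * f' s - Real.sinh ξ ^ k * f' ξ| +
      |Real.sinh ξ ^ k * f' ξ| := by
    have := abs_add_le (Real.sinh s ^ k * f' s - Real.sinh ξ ^ k * f' ξ) (Real.sinh ξ ^ k * f' ξ)
    simpa using this
  have h5 : Λ * Real.sinh s ^ k * M * (s - ξ) ≤ Λ * Real.sinh s ^ k * M * s := by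
    gcongr; linarith
  rw [h3]
  nlinarith

theorem tendsto_deriv (hf : IsRadialSolution k Λ f f' a) (hk : 1 ≤ k) (hΛ : 0 ≤ Λ) :
    Tendsto f' (𝓝[>] 0) (𝓝 0) := by
  have hM : ∀ᶠ x in 𝓝[>] 0, |f x| < |a| + 1 :=
    hf.tendsto.abs.eventually (gt_mem_nhds (lt_add_one _))
  obtain ⟨δ, hδ, hδM⟩ := mem_nhdsGT_iff_exists_Ioo_subset.1 hM
  have hlim : Tendsto (fun x : ℝ => Λ * (|a| + 1) * x) (𝓝[>] 0) (𝓝 0) := by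
    have : Tendsto (fun x : ℝ => Λ * (|a| + 1) * x) (𝓝 0) (𝓝 (Λ * (|a| + 1) * 0)) :=
      (continuous_const.mul continuous_id).tendsto 0
    rw [mul_zero] at this
    exact this.mono_left nhdsWithin_le_nhds
  refine squeeze_zero_norm' ?_ hlim
  filter_upwards [Ioo_mem_nhdsGT hδ] with s hs
  exact hf.abs_deriv_le hk hΛ hs.1 fun x hx hxs => (hδM ⟨hx, hxs.trans_lt hs.2⟩).le

/-- The first-order term of the equation is a friction with positive coefficient `k coth t`, so the
energy decreases. Its limit at the origin is `Λ * a ^ 2` because `f' → 0`. -/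
theorem energy_le (hf : IsRadialSolution k Λ f f' a) (hk : 1 ≤ k) (hΛ : 0 ≤ Λ) {t : ℝ}
    (ht : 0 < t) : f' t ^ 2 + Λ * f t ^ 2 ≤ Λ * a ^ 2 := by
  have hanti : AntitoneOn (fun x => f' x ^ 2 + Λ * f x ^ 2) (Set.Ioi 0) := by
    have hd : ∀ x : ℝ, 0 < x → HasDerivAt (fun x => f' x ^ 2 + Λ * f x ^ 2)
        (-(2 * k * (Real.cosh x / Real.sinh x) * f' x ^ 2)) x := fun x hx =>
      (((hf.hasDerivAt' x hx).pow 2).add (((hf.hasDerivAt x hx).pow 2).const_mul Λ)).congr_deriv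
        (by push_cast; ring)
    refine antitoneOn_of_hasDerivWithinAt_nonpos (convex_Ioi 0)
      (fun x hx => (hd x hx).continuousAt.continuousWithinAt)
      (fun x hx => (hd x (by simpa using hx)).hasDerivWithinAt) fun x hx => ?_
    have hx : 0 < x := by simpa using hx
    have := Real.sinh_pos_iff.2 hx
    have := Real.cosh_pos x
    rw [neg_nonpos]
    positivity
  have hlim : Tendsto (fun x => f' x ^ 2 + Λ * f x ^ 2) (𝓝[>] 0) (𝓝 (0 ^ 2 + Λ * a ^ 2)) :=
    ((hf.tendsto_deriv hk hΛ).pow 2).add ((hf.tendsto.pow 2).const_mul Λ)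
  rw [zero_pow two_ne_zero, zero_add] at hlim
  refine ge_of_tendsto hlim ?_
  filter_upwards [Ioo_mem_nhdsGT ht] with x hx
  exact hanti hx.1 ht hx.2.le

theorem abs_le (hf : IsRadialSolution k Λ f f' a) (hk : 1 ≤ k) (hΛ : 0 < Λ) {t : ℝ}
    (ht : 0 < t) : |f t| ≤ |a| := by
  have := hf.energy_le hk hΛ.le ht
  refine sq_le_sq.1 (le_of_mul_le_mul_left ?_ hΛ)
  nlinarith [sq_nonneg (f' t)]

/-- A solution is determined by its limit at the origin. -/
theorem eq (hf : IsRadialSolution k Λ f f' a) (hg : IsRadialSolution k Λ g g' a) (hk : 1 ≤ k)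
    (hΛ : 0 < Λ) {t : ℝ} (ht : 0 < t) : f t = g t := by
  have := (hf.sub hg).abs_le hk hΛ ht
  rw [sub_self, abs_zero] at this
  exact sub_eq_zero.1 (abs_nonpos_iff.1 this)

end IsRadialSolution

/-! ### From the complex eigenfunction in curvature `-1/ρ²` to real solutions in curvature `-1`. -/

theorem IsRadialEigenfunction.hasDerivAt {k : ℕ} {ρ : ℝ} {lam : ℂ} {φ : ℝ → ℂ}
    (h : IsRadialEigenfunction k ρ lam φ) {r : ℝ} (hr : 0 < r) :
    HasDerivAt φ (deriv φ r) r :=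
  ((h.contDiffOn.differentiableOn (by norm_num)).differentiableAt
    (Ioi_mem_nhds hr)).hasDerivAt

theorem IsRadialEigenfunction.hasDerivAt_deriv {k : ℕ} {ρ : ℝ} {lam : ℂ} {φ : ℝ → ℂ}
    (h : IsRadialEigenfunction k ρ lam φ) {r : ℝ} (hr : 0 < r) :
    HasDerivAt (deriv φ) (-((k : ℝ) / ρ * (Real.cosh (r / ρ) / Real.sinh (r / ρ)) : ℝ) * deriv φ r
      - lam * φ r) r := by
  have h1 : ContDiffOn ℝ 1 (deriv φ) (Set.Ioi 0) :=
    ((contDiffOn_succ_iff_deriv_of_isOpen (n := 1) isOpen_Ioi).1 h.contDiffOn).2.2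
  have h2 := ((h1.differentiableOn (by norm_num)).differentiableAt (Ioi_mem_nhds hr)).hasDerivAt
  refine h2.congr_deriv ?_
  have := h.eigen r hr
  unfold hyperbolicRadialLaplacian at this
  linear_combination this

theorem IsRadialEigenfunction.tendsto {k : ℕ} {ρ : ℝ} {lam : ℂ} {φ : ℝ → ℂ}
    (h : IsRadialEigenfunction k ρ lam φ) : Tendsto φ (𝓝[>] 0) (𝓝 1) := by
  have := h.continuousOn 0 Set.self_mem_Ici
  rw [ContinuousWithinAt, h.map_zero] at this
  exact this.mono_left (nhdsWithin_mono _ Set.Ioi_subset_Ici_self)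

/-- The coefficients of the equation are real, so every real-linear functional preserves it. It is
applied to the real and imaginary parts. -/
theorem IsRadialEigenfunction.isRadialSolution {k : ℕ} {ρ lam : ℝ} {φ : ℝ → ℂ} (hρ : 0 < ρ)
    (h : IsRadialEigenfunction k ρ lam φ) (L : ℂ →L[ℝ] ℝ) :
    IsRadialSolution k (lam * ρ ^ 2) (fun t => L (φ (ρ * t))) (fun t => ρ * L (deriv φ (ρ * t)))
      (L 1) where
  hasDerivAt t ht := by
    have h1 := (h.hasDerivAt (mul_pos hρ ht)).scomp t ((hasDerivAt_id t).const_mul ρ)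
    refine (L.hasFDerivAt.comp_hasDerivAt t h1).congr_deriv ?_
    rw [mul_one, map_smul, smul_eq_mul]
  hasDerivAt' t ht := by
    have h1 := (h.hasDerivAt_deriv (mul_pos hρ ht)).scomp t ((hasDerivAt_id t).const_mul ρ)
    refine ((L.hasFDerivAt.comp_hasDerivAt t h1).const_mul ρ).congr_deriv ?_
    have e : ρ * t / ρ = t := by field_simp
    have hL : ∀ (x : ℝ) (z : ℂ), L ((x : ℂ) * z) = x * L z := fun x z => by
      rw [← Complex.real_smul, map_smul, smul_eq_mul]
    rw [e, mul_one, map_smul, map_sub, ← Complex.ofReal_neg, hL, hL, smul_eq_mul]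
    field_simp
  tendsto := by
    have h2 := tendsto_const_mul_nhdsGT_zero hρ
    exact (L.continuous.tendsto 1).comp (h.tendsto.comp h2)

/-- The imaginary part is a solution with limit `0` at the origin, hence vanishes by the energy
bound. -/
theorem IsRadialEigenfunction.eq_ofReal {k : ℕ} {ρ lam : ℝ} {φ : ℝ → ℂ} (hρ : 0 < ρ) (hk : 1 ≤ k)
    (hlam : 0 < lam) (h : IsRadialEigenfunction k ρ lam φ) {r : ℝ} (hr : 0 < r) :
    φ r = ((φ r).re : ℂ) := by
  have him := (h.isRadialSolution hρ Complex.imCLM).abs_le hk (by positivity)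
    (div_pos hr hρ)
  rw [mul_div_cancel₀ r hρ.ne'] at him
  simp only [Complex.imCLM_apply, Complex.one_im, abs_zero] at him
  exact Complex.ext rfl (by simpa using abs_nonpos_iff.1 him)

/-! ### Closed forms for `k = 2` and `k = 4`. -/

theorem hasDerivAt_sin_const_mul (b t : ℝ) :
    HasDerivAt (fun x => Real.sin (b * x)) (b * Real.cos (b * t)) t :=
  (((hasDerivAt_id t).const_mul b).sin).congr_deriv (by simp [mul_comm])

theorem hasDerivAt_cos_const_mul (b t : ℝ) :
    HasDerivAt (fun x => Real.cos (b * x)) (-(b * Real.sin (b * t))) t :=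
  (((hasDerivAt_id t).const_mul b).cos).congr_deriv (by simp [mul_comm])

theorem isRadialSolution_two {b : ℝ} (hb : 0 < b) :
    IsRadialSolution 2 (1 + b ^ 2) (fun t => Real.sin (b * t) / (b * Real.sinh t))
      (fun t => (b * Real.cos (b * t) * Real.sinh t - Real.sin (b * t) * Real.cosh t) /
        (b * Real.sinh t ^ 2)) 1 where
  hasDerivAt t ht := by
    have hs := (Real.sinh_pos_iff.2 ht).ne'
    refine ((hasDerivAt_sin_const_mul b t).div ((Real.hasDerivAt_sinh t).const_mul b)
      (mul_ne_zero hb.ne' hs)).congr_deriv ?_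
    field_simp
  hasDerivAt' t ht := by
    have hs := (Real.sinh_pos_iff.2 ht).ne'
    refine (((((hasDerivAt_cos_const_mul b t).const_mul b).mul (Real.hasDerivAt_sinh t)).sub
      ((hasDerivAt_sin_const_mul b t).mul (Real.hasDerivAt_cosh t))).div
      (((Real.hasDerivAt_sinh t).pow 2).const_mul b)
      (mul_ne_zero hb.ne' (pow_ne_zero 2 hs))).congr_deriv ?_
    simp only [Pi.pow_apply, Pi.mul_apply, Pi.sub_apply]
    push_cast
    field_simp
    ring
  tendsto := by
    have h := HasDerivAt.lhopital_zero_nhdsGT (a := 0) (l := 𝓝 1)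
      (f := fun x => Real.sin (b * x)) (g := fun x => b * Real.sinh x)
      (Eventually.of_forall fun x => hasDerivAt_sin_const_mul b x)
      (Eventually.of_forall fun x => (Real.hasDerivAt_sinh x).const_mul b)
      (Eventually.of_forall fun x => (mul_pos hb (Real.cosh_pos x)).ne') ?_ ?_ ?_
    · exact h
    · have : Continuous fun x : ℝ => Real.sin (b * x) := by fun_prop
      simpa using (this.tendsto 0).mono_left (nhdsWithin_le_nhds (s := Set.Ioi 0))
    · have : Continuous fun x : ℝ => b * Real.sinh x := by fun_prop
      simpa using (this.tendsto 0).mono_left (nhdsWithin_le_nhds (s := Set.Ioi 0))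
    · have : Continuous fun x : ℝ => b * Real.cos (b * x) / (b * Real.cosh x) := by
        refine Continuous.div (by fun_prop) (by fun_prop) fun x =>
          (mul_pos hb (Real.cosh_pos x)).ne'
      simpa [hb.ne'] using (this.tendsto 0).mono_left (nhdsWithin_le_nhds (s := Set.Ioi 0))

theorem hasDerivAt_sin_mul_cosh_sub (b t : ℝ) :
    HasDerivAt (fun x => Real.sin (b * x) * Real.cosh x - b * Real.cos (b * x) * Real.sinh x)
      ((1 + b ^ 2) * (Real.sin (b * t) * Real.sinh t)) t :=
  (((hasDerivAt_sin_const_mul b t).mul (Real.hasDerivAt_cosh t)).sub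
    (((hasDerivAt_cos_const_mul b t).const_mul b).mul (Real.hasDerivAt_sinh t))).congr_deriv
    (by ring)

/-- Up to a constant this is `(1 / sinh t) d/dt` applied to the solution for `k = 2`. The numerator
behaves like `b (1 + b ^ 2) t ^ 3 / 3` at the origin, which fixes the normalization. -/
theorem isRadialSolution_four {b : ℝ} (hb : 0 < b) :
    IsRadialSolution 4 (4 + b ^ 2)
      (fun t => (Real.sin (b * t) * Real.cosh t - b * Real.cos (b * t) * Real.sinh t) /
        (b * (1 + b ^ 2) / 3 * Real.sinh t ^ 3))
      (fun t => 3 * ((1 + b ^ 2) * (Real.sin (b * t) * Real.sinh t ^ 2) - 3 * Real.cosh t *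
        (Real.sin (b * t) * Real.cosh t - b * Real.cos (b * t) * Real.sinh t)) /
        (b * (1 + b ^ 2) * Real.sinh t ^ 4)) 1 where
  hasDerivAt t ht := by
    have hs := (Real.sinh_pos_iff.2 ht).ne'
    have hb2 : 1 + b ^ 2 ≠ 0 := by positivity
    refine ((hasDerivAt_sin_mul_cosh_sub b t).div
      (((Real.hasDerivAt_sinh t).pow 3).const_mul (b * (1 + b ^ 2) / 3))
      (by simp only [Pi.pow_apply]; positivity)).congr_deriv ?_
    simp only [Pi.pow_apply]
    push_cast
    field_simp
  hasDerivAt' t ht := by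
    have hs := (Real.sinh_pos_iff.2 ht).ne'
    have hb2 : 1 + b ^ 2 ≠ 0 := by positivity
    refine ((((((hasDerivAt_sin_const_mul b t).mul ((Real.hasDerivAt_sinh t).pow 2)).const_mul
      (1 + b ^ 2)).sub (((Real.hasDerivAt_cosh t).const_mul 3).mul
      (hasDerivAt_sin_mul_cosh_sub b t))).const_mul 3).div
      (((Real.hasDerivAt_sinh t).pow 4).const_mul (b * (1 + b ^ 2)))
      (by simp only [Pi.pow_apply]; positivity)).congr_deriv ?_
    simp only [Pi.pow_apply, Pi.mul_apply, Pi.sub_apply]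
    push_cast
    field_simp
    ring
  tendsto := by
    have h0 : ∀ x : ℝ, 0 < x → 0 < Real.sinh x := fun x hx => Real.sinh_pos_iff.2 hx
    have hb2 : 1 + b ^ 2 ≠ 0 := by positivity
    have h := HasDerivAt.lhopital_zero_nhdsGT (a := 0) (l := 𝓝 1)
      (f := fun x => Real.sin (b * x) * Real.cosh x - b * Real.cos (b * x) * Real.sinh x)
      (g := fun x => b * (1 + b ^ 2) / 3 * Real.sinh x ^ 3)
      (g' := fun x => b * (1 + b ^ 2) * Real.sinh x ^ 2 * Real.cosh x)
      (Eventually.of_forall fun x => hasDerivAt_sin_mul_cosh_sub b x)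
      (Eventually.of_forall fun x => (((Real.hasDerivAt_sinh x).pow 3).const_mul
        (b * (1 + b ^ 2) / 3)).congr_deriv (by push_cast; ring)) ?_ ?_ ?_ ?_
    · exact h
    · filter_upwards [self_mem_nhdsWithin] with x hx
      have := h0 x hx
      have := Real.cosh_pos x
      positivity
    · have : Continuous fun x : ℝ =>
        Real.sin (b * x) * Real.cosh x - b * Real.cos (b * x) * Real.sinh x := by fun_prop
      simpa using (this.tendsto 0).mono_left (nhdsWithin_le_nhds (s := Set.Ioi 0))
    · have : Continuous fun x : ℝ => b * (1 + b ^ 2) / 3 * Real.sinh x ^ 3 := by fun_prop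
      simpa using (this.tendsto 0).mono_left (nhdsWithin_le_nhds (s := Set.Ioi 0))
    -- The quotient of the derivatives is the solution for `k = 2` divided by `cosh`.
    · have h1 := (isRadialSolution_two hb).tendsto
      have h2 : Tendsto Real.cosh (𝓝[>] 0) (𝓝 1) := by
        simpa using (Real.continuous_cosh.tendsto 0).mono_left
          (nhdsWithin_le_nhds (s := Set.Ioi 0))
      have h3 := h1.div h2 one_ne_zero
      rw [div_one] at h3
      refine h3.congr' ?_
      filter_upwards [self_mem_nhdsWithin] with x hx
      have := (h0 x hx).ne'
      have := (Real.cosh_pos x).ne'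
      simp only [Pi.div_apply]
      field_simp

/-! ### Replacing `√(Λ - c)` by `√Λ`, and the asymptotics for `k = 2` and `k = 4`. -/

theorem tendsto_sqrt_sub_sqrt (c : ℝ) :
    Tendsto (fun x : ℝ => Real.sqrt x - Real.sqrt (x - c)) atTop (𝓝 0) := by
  have h : Tendsto (fun x : ℝ => |c| / Real.sqrt x) atTop (𝓝 0) :=
    tendsto_const_nhds.div_atTop Real.tendsto_sqrt_atTop
  refine squeeze_zero_norm' ?_ h
  filter_upwards [eventually_gt_atTop 0, eventually_ge_atTop c] with x hx hc
  have h1 := Real.sqrt_pos.2 hx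
  have h2 := Real.sqrt_nonneg (x - c)
  have h3 := Real.sq_sqrt hx.le
  have h4 := Real.sq_sqrt (sub_nonneg.2 hc)
  rw [le_div_iff₀ h1, Real.norm_eq_abs]
  calc _ ≤ |Real.sqrt x - Real.sqrt (x - c)| * (Real.sqrt x + Real.sqrt (x - c)) := by
        gcongr; linarith
    _ = |(Real.sqrt x - Real.sqrt (x - c)) * (Real.sqrt x + Real.sqrt (x - c))| := by
        rw [abs_mul, abs_of_nonneg (by positivity : 0 ≤ Real.sqrt x + Real.sqrt (x - c))]
    _ = |c| := by congr 1; linear_combination h3 - h4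

theorem tendsto_sqrt_sub_atTop (c : ℝ) : Tendsto (fun x : ℝ => Real.sqrt (x - c)) atTop atTop :=
  Real.tendsto_sqrt_atTop.comp (tendsto_atTop_add_const_right _ _ tendsto_id)

theorem tendsto_sqrt_div_sqrt (c : ℝ) :
    Tendsto (fun x : ℝ => Real.sqrt x / Real.sqrt (x - c)) atTop (𝓝 1) := by
  have h := (((tendsto_sqrt_sub_sqrt c).div_atTop (tendsto_sqrt_sub_atTop c)).const_add 1)
  rw [add_zero] at h
  refine h.congr' ?_
  filter_upwards [eventually_gt_atTop c] with x hx
  have := (Real.sqrt_pos.2 (sub_pos.2 hx)).ne'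
  field_simp
  ring

theorem tendsto_sin_sub_sin (c t : ℝ) :
    Tendsto (fun x : ℝ => Real.sin (Real.sqrt (x - c) * t) - Real.sin (Real.sqrt x * t))
      atTop (𝓝 0) := by
  have h := ((tendsto_sqrt_sub_sqrt c).mul_const t).abs
  simp only [zero_mul, abs_zero] at h
  refine squeeze_zero_norm (fun x => ?_) h
  have := Real.lipschitzWith_sin.dist_le_mul (Real.sqrt (x - c) * t) (Real.sqrt x * t)
  rw [Real.dist_eq, Real.dist_eq] at this
  rw [Real.norm_eq_abs, sub_mul, abs_sub_comm (Real.sqrt x * t)]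
  simpa using this

theorem tendsto_cos_sub_cos (c d t : ℝ) :
    Tendsto (fun x : ℝ => Real.cos (d - Real.sqrt (x - c) * t) - Real.cos (d - Real.sqrt x * t))
      atTop (𝓝 0) := by
  have h := ((tendsto_sqrt_sub_sqrt c).mul_const t).abs
  simp only [zero_mul, abs_zero] at h
  refine squeeze_zero_norm (fun x => ?_) h
  have := Real.lipschitzWith_cos.dist_le_mul (d - Real.sqrt (x - c) * t) (d - Real.sqrt x * t)
  rw [Real.dist_eq, Real.dist_eq] at this
  rw [Real.norm_eq_abs, sub_mul]
  simpa using this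

theorem IsRadialSolution.eq_sin_div {Λ : ℝ} {f f' : ℝ → ℝ} (hf : IsRadialSolution 2 Λ f f' 1)
    (hΛ : 1 < Λ) {t : ℝ} (ht : 0 < t) :
    f t = Real.sin (Real.sqrt (Λ - 1) * t) / (Real.sqrt (Λ - 1) * Real.sinh t) := by
  have hb := Real.sqrt_pos.2 (sub_pos.2 hΛ)
  have h := isRadialSolution_two hb
  rw [Real.sq_sqrt (sub_pos.2 hΛ).le, add_sub_cancel] at h
  exact hf.eq h one_le_two (by linarith) ht

theorem tendsto_of_isRadialSolution_two {f f' : ℝ → ℝ → ℝ}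
    (hf : ∀ Λ, 0 < Λ → IsRadialSolution 2 Λ (f Λ) (f' Λ) 1) {t : ℝ} (ht : 0 < t) :
    Tendsto (fun Λ => Real.sqrt Λ * f Λ t - Real.sin (Real.sqrt Λ * t) / Real.sinh t)
      atTop (𝓝 0) := by
  have hs := (Real.sinh_pos_iff.2 ht).ne'
  have h1 : Tendsto (fun Λ : ℝ => (Real.sqrt Λ / Real.sqrt (Λ - 1) - 1) *
      Real.sin (Real.sqrt (Λ - 1) * t)) atTop (𝓝 0) := by
    have h : Tendsto (fun Λ : ℝ => Real.sqrt Λ / Real.sqrt (Λ - 1) - 1) atTop (𝓝 0) := by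
      simpa using (tendsto_sqrt_div_sqrt 1).sub_const 1
    exact h.zero_mul_isBoundedUnder_le (isBoundedUnder_of
      ⟨1, fun x => by simpa using Real.abs_sin_le_one _⟩)
  have h2 := (h1.add (tendsto_sin_sub_sin 1 t)).div_const (Real.sinh t)
  rw [add_zero, zero_div] at h2
  refine h2.congr' ?_
  filter_upwards [eventually_gt_atTop 1] with Λ hΛ
  rw [(hf Λ (by linarith)).eq_sin_div hΛ ht]
  have := (Real.sqrt_pos.2 (sub_pos.2 hΛ)).ne'
  field_simp
  ring

theorem tendsto_of_isRadialSolution_four {f f' : ℝ → ℝ → ℝ}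
    (hf : ∀ Λ, 0 < Λ → IsRadialSolution 4 Λ (f Λ) (f' Λ) 1) {t : ℝ} (ht : 0 < t) :
    Tendsto (fun Λ => Λ * f Λ t + 3 * Real.cos (Real.sqrt Λ * t) / Real.sinh t ^ 2)
      atTop (𝓝 0) := by
  have hs := (Real.sinh_pos_iff.2 ht).ne'
  have hsin : IsBoundedUnder (· ≤ ·) atTop
      (norm ∘ fun Λ : ℝ => Real.sin (Real.sqrt (Λ - 4) * t)) :=
    isBoundedUnder_of ⟨1, fun x => by simpa using Real.abs_sin_le_one _⟩
  have hcos : IsBoundedUnder (· ≤ ·) atTop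
      (norm ∘ fun Λ : ℝ => Real.cos (Real.sqrt (Λ - 4) * t)) :=
    isBoundedUnder_of ⟨1, fun x => by simpa using Real.abs_cos_le_one _⟩
  -- With `b ^ 2 = Λ - 4` the denominator contains `1 + b ^ 2 = Λ - 3`, and `Λ / (Λ - 3) = 1 + 3 /
  -- (Λ - 3)`. The sine term keeps a further factor `1 / b`, so only the cosine term survives.
  have hq0 : Tendsto (fun Λ : ℝ => 3 / (Λ - 3)) atTop (𝓝 0) :=
    tendsto_const_nhds.div_atTop (tendsto_atTop_add_const_right _ _ tendsto_id)
  have hq : Tendsto (fun Λ : ℝ => 1 + 3 / (Λ - 3)) atTop (𝓝 1) := by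
    simpa using hq0.const_add 1
  have h1 : Tendsto (fun Λ : ℝ => (1 + 3 / (Λ - 3)) * (1 / Real.sqrt (Λ - 4)) *
      Real.sin (Real.sqrt (Λ - 4) * t)) atTop (𝓝 0) := by
    have h : Tendsto (fun Λ : ℝ => (1 + 3 / (Λ - 3)) * (1 / Real.sqrt (Λ - 4))) atTop (𝓝 0) := by
      simpa using hq.mul ((tendsto_const_nhds (x := (1 : ℝ))).div_atTop (tendsto_sqrt_sub_atTop 4))
    exact h.zero_mul_isBoundedUnder_le hsin
  have h2 := hq0.zero_mul_isBoundedUnder_le hcos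
  have h3 := tendsto_cos_sub_cos 4 0 t
  have h4 := (h1.const_mul (3 * Real.cosh t / Real.sinh t ^ 3)).sub
    ((h2.add h3).const_mul (3 / Real.sinh t ^ 2))
  simp only [mul_zero, add_zero, sub_zero] at h4
  refine h4.congr' ?_
  filter_upwards [eventually_gt_atTop 4] with Λ hΛ
  have hb := Real.sqrt_pos.2 (sub_pos.2 hΛ)
  have h := isRadialSolution_four hb
  have hsq := Real.sq_sqrt (sub_pos.2 hΛ).le
  rw [hsq, add_sub_cancel] at h
  rw [(hf Λ (by linarith)).eq h (by norm_num) (by linarith) ht]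
  have h5 : Λ - 3 ≠ 0 := by linarith
  rw [show 1 + (Λ - 4) = Λ - 3 by ring]
  simp only [zero_sub, Real.cos_neg]
  field_simp
  ring

/-! ### Decay for `k ≥ 3` by a second energy. -/

theorem hasDerivAt_coth {t : ℝ} (ht : 0 < t) :
    HasDerivAt (fun x => Real.cosh x / Real.sinh x) (-(1 / Real.sinh t ^ 2)) t := by
  have hs := (Real.sinh_pos_iff.2 ht).ne'
  refine ((Real.hasDerivAt_cosh t).div (Real.hasDerivAt_sinh t) hs).congr_deriv ?_
  have := Real.cosh_sq t
  field_simp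
  linear_combination -this

theorem hasDerivAt_const_sub_div_sinh_sq (p d : ℝ) {t : ℝ} (ht : 0 < t) :
    HasDerivAt (fun x => p - d / Real.sinh x ^ 2) (2 * d * Real.cosh t / Real.sinh t ^ 3) t := by
  have hs := (Real.sinh_pos_iff.2 ht).ne'
  refine (((hasDerivAt_const t d).div ((Real.hasDerivAt_sinh t).pow 2)
    (pow_ne_zero 2 hs)).const_sub p).congr_deriv ?_
  simp only [Pi.pow_apply]
  push_cast
  field_simp
  ring

namespace IsRadialSolution

variable {k : ℕ} {Λ : ℝ} {f f' : ℝ → ℝ} {a : ℝ}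

/-- With `w = sinh ^ (k / 2) * f`, so that `w'' + p w = 0` with `p` increasing, the derivative of
`w' ^ 2 / p + w ^ 2` is `- p' w' ^ 2 / p ^ 2`. -/
theorem hasDerivAt_energy (hf : IsRadialSolution k Λ f f' a) {c : ℝ} (hc : (k : ℝ) = 2 * c)
    {t : ℝ} (ht : 0 < t) (hp : Λ - c ^ 2 - c * (c - 1) / Real.sinh t ^ 2 ≠ 0) :
    HasDerivAt (fun x => Real.sinh x ^ k *
        ((f' x + c * (Real.cosh x / Real.sinh x) * f x) ^ 2 /
          (Λ - c ^ 2 - c * (c - 1) / Real.sinh x ^ 2) + f x ^ 2))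
      (-(Real.sinh t ^ k * (2 * (c * (c - 1)) * Real.cosh t / Real.sinh t ^ 3 *
        ((f' t + c * (Real.cosh t / Real.sinh t) * f t) ^ 2 /
          (Λ - c ^ 2 - c * (c - 1) / Real.sinh t ^ 2) ^ 2)))) t := by
  have hs := (Real.sinh_pos_iff.2 ht).ne'
  have hS : HasDerivAt (fun x => Real.sinh x ^ k)
      (2 * c * (Real.cosh t / Real.sinh t) * Real.sinh t ^ k) t := by
    refine ((Real.hasDerivAt_sinh t).pow k).congr_deriv ?_
    rw [← hc]
    rcases Nat.eq_zero_or_pos k with rfl | hk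
    · simp
    · obtain ⟨m, rfl⟩ : ∃ m, k = m + 1 := ⟨k - 1, by omega⟩
      simp only [Nat.add_sub_cancel, pow_succ]
      field_simp
  have hW : HasDerivAt (fun x => f' x + c * (Real.cosh x / Real.sinh x) * f x)
      (-(c * (Real.cosh t / Real.sinh t)) * f' t - (Λ + c / Real.sinh t ^ 2) * f t) t := by
    refine ((hf.hasDerivAt' t ht).add (((hasDerivAt_coth ht).const_mul c).mul
      (hf.hasDerivAt t ht))).congr_deriv ?_
    rw [hc]
    ring
  have hP := hasDerivAt_const_sub_div_sinh_sq (Λ - c ^ 2) (c * (c - 1)) ht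
  refine (hS.mul (((hW.pow 2).div hP hp).add ((hf.hasDerivAt t ht).pow 2))).congr_deriv ?_
  have h := Real.cosh_sq t
  simp only [Pi.pow_apply, Pi.add_apply, Pi.div_apply]
  -- Writing `W = f' + c coth * f`, so that `w' = sinh ^ c * W`, this is `W' = -p f - c coth * W`,
  -- the equation `w'' = -p w` divided by `sinh ^ c`.
  have key : -(c * (Real.cosh t / Real.sinh t)) * f' t - (Λ + c / Real.sinh t ^ 2) * f t =
      -(Λ - c ^ 2 - c * (c - 1) / Real.sinh t ^ 2) * f t -
      c * (Real.cosh t / Real.sinh t) * (f' t + c * (Real.cosh t / Real.sinh t) * f t) := by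
    field_simp
    linear_combination (c ^ 2 * f t) * h
  rw [key]
  generalize Λ - c ^ 2 - c * (c - 1) / Real.sinh t ^ 2 = p at *
  generalize hw : f' t + c * (Real.cosh t / Real.sinh t) * f t = W at *
  rw [← eq_sub_iff_add_eq] at hw
  rw [hw]
  field_simp
  push_cast
  ring

/-- The second energy is compared at `t` and at `s`, where `sinh s = k / √Λ`. This `s` is large
enough for `p ≥ Λ / 2` on `[s, t]`, and small enough for the weight `sinh s ^ k` to give the decay.
At `s` the first energy gives `|f| ≤ 1` and `|f'| ≤ √Λ`, so `W ^ 2 / p + f ^ 2 ≤ 4Λ / (Λ / 2) + 1 =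
9`. -/
theorem sinh_pow_mul_sq_le (hf : IsRadialSolution k Λ f f' 1) (hk : 2 ≤ k) {t : ℝ} (ht : 0 < t)
    (hΛ : (k : ℝ) ^ 2 ≤ Λ) (htΛ : k / Real.sqrt Λ ≤ Real.sinh t) :
    Real.sinh t ^ k * f t ^ 2 ≤ 9 * (k / Real.sqrt Λ) ^ k := by
  have hk0 : (2 : ℝ) ≤ k := by exact_mod_cast hk
  have hΛ0 : 0 < Λ := by nlinarith
  have hq0 := Real.sqrt_pos.2 hΛ0
  have hqs := Real.sq_sqrt hΛ0.le
  have hkq : (k : ℝ) ≤ Real.sqrt Λ := Real.le_sqrt_of_sq_le hΛ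
  obtain ⟨c, hc⟩ : ∃ c : ℝ, (k : ℝ) = 2 * c := ⟨k / 2, by ring⟩
  have hc1 : 1 ≤ c := by linarith
  set s := Real.arsinh (k / Real.sqrt Λ) with hsdef
  have hs : Real.sinh s = k / Real.sqrt Λ := Real.sinh_arsinh _
  have hs0 : 0 < s := Real.arsinh_pos_iff.2 (by positivity)
  have hst : s ≤ t := Real.sinh_le_sinh.1 (hs ▸ htΛ)
  have hp : ∀ x, s ≤ x → Λ / 2 ≤ Λ - c ^ 2 - c * (c - 1) / Real.sinh x ^ 2 := by
    intro x hx
    have h1 : Real.sinh s ≤ Real.sinh x := Real.sinh_le_sinh.2 hx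
    have h2 : 0 < Real.sinh s := Real.sinh_pos_iff.2 hs0
    have h3 : c * (c - 1) / Real.sinh x ^ 2 ≤ c * (c - 1) / Real.sinh s ^ 2 := by
      have : 0 ≤ c * (c - 1) := mul_nonneg (by linarith) (by linarith)
      gcongr
    -- With `k = 2c` the left side equals `Λ (c - 1) / (4c)`; the hypothesis `k ^ 2 ≤ Λ` also gives
    -- `c ^ 2 ≤ Λ / 4`, so `p` loses at most `Λ / 2`.
    have h4 : c * (c - 1) / Real.sinh s ^ 2 ≤ Λ / 4 := by
      rw [hs, hc, div_pow, hqs, div_div_eq_mul_div, div_le_iff₀ (by positivity)]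
      nlinarith
    rw [hc] at hΛ
    nlinarith
  have hanti : AntitoneOn (fun x => Real.sinh x ^ k *
        ((f' x + c * (Real.cosh x / Real.sinh x) * f x) ^ 2 /
          (Λ - c ^ 2 - c * (c - 1) / Real.sinh x ^ 2) + f x ^ 2)) (Set.Icc s t) := by
    have hd := fun (x : ℝ) (hx : s ≤ x) => hf.hasDerivAt_energy hc (hs0.trans_le hx)
      (by have := hp x hx; linarith)
    refine antitoneOn_of_hasDerivWithinAt_nonpos (convex_Icc s t)
      (fun x hx => (hd x hx.1).continuousAt.continuousWithinAt)
      (fun x hx => (hd x (interior_subset hx).1).hasDerivWithinAt) fun x hx => ?_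
    have := Real.sinh_pos_iff.2 (hs0.trans_le (interior_subset hx).1)
    have := Real.cosh_pos x
    have : 0 ≤ c - 1 := by linarith
    rw [neg_nonpos]
    positivity
  have hmain := hanti (Set.left_mem_Icc.2 hst) (Set.right_mem_Icc.2 hst) hst
  simp only at hmain
  have hpt := hp t hst
  have hSt : 0 < Real.sinh t := Real.sinh_pos_iff.2 ht
  have hSs : 0 < Real.sinh s := Real.sinh_pos_iff.2 hs0
  have hfs : |f s| ≤ 1 := by simpa using hf.abs_le (by omega) hΛ0 hs0
  have hen := hf.energy_le (by omega) hΛ0.le hs0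
  have hfs' : |f' s| ≤ Real.sqrt Λ := by
    refine Real.abs_le_sqrt ?_
    nlinarith [sq_nonneg (f s)]
  have hS1 : Real.sinh s ≤ 1 := by rw [hs]; exact (div_le_one hq0).2 hkq
  have hcosh : Real.cosh s ≤ 2 := by
    have := Real.cosh_sq s
    have := Real.cosh_pos s
    nlinarith
  have hcoth : c * (Real.cosh s / Real.sinh s) ≤ Real.sqrt Λ := by
    rw [hs, hc]
    have : c * (Real.cosh s / (2 * c / Real.sqrt Λ)) = Real.cosh s / 2 * Real.sqrt Λ := by
      have : c ≠ 0 := by linarith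
      field_simp
    rw [this]
    nlinarith
  have hW : |f' s + c * (Real.cosh s / Real.sinh s) * f s| ≤ 2 * Real.sqrt Λ := by
    have h0 : 0 ≤ c * (Real.cosh s / Real.sinh s) := by
      have := Real.cosh_pos s
      positivity
    calc _ ≤ |f' s| + |c * (Real.cosh s / Real.sinh s) * f s| := abs_add_le _ _
      _ ≤ Real.sqrt Λ + Real.sqrt Λ * 1 := by
          rw [abs_mul, abs_of_nonneg h0]
          gcongr
      _ = 2 * Real.sqrt Λ := by ring
  have hW2 : (f' s + c * (Real.cosh s / Real.sinh s) * f s) ^ 2 ≤ 4 * Λ := by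
    have := pow_le_pow_left₀ (abs_nonneg _) hW 2
    rw [sq_abs, mul_pow, hqs] at this
    linarith
  have hps := hp s le_rfl
  calc _ ≤ Real.sinh t ^ k * ((f' t + c * (Real.cosh t / Real.sinh t) * f t) ^ 2 /
          (Λ - c ^ 2 - c * (c - 1) / Real.sinh t ^ 2) + f t ^ 2) := by
        gcongr
        refine le_add_of_nonneg_left (div_nonneg (sq_nonneg _) ?_)
        linarith
    _ ≤ _ := hmain
    _ ≤ Real.sinh s ^ k * ((4 * Λ) / (Λ / 2) + 1) := by
        gcongr
        exact (sq_le_one_iff_abs_le_one _).2 hfs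
    _ = 9 * (k / Real.sqrt Λ) ^ k := by
        rw [hs]
        field_simp
        ring

end IsRadialSolution

theorem tendsto_sqrt_mul_of_isRadialSolution {k : ℕ} {f f' : ℝ → ℝ → ℝ} (hk : 3 ≤ k)
    (hf : ∀ Λ, 0 < Λ → IsRadialSolution k Λ (f Λ) (f' Λ) 1) {t : ℝ} (ht : 0 < t) :
    Tendsto (fun Λ => Real.sqrt Λ * f Λ t) atTop (𝓝 0) := by
  have hS : 0 < Real.sinh t := Real.sinh_pos_iff.2 ht
  have hz : Tendsto (fun Λ : ℝ => k / Real.sqrt Λ) atTop (𝓝 0) :=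
    tendsto_const_nhds.div_atTop Real.tendsto_sqrt_atTop
  have h0 : Tendsto (fun Λ : ℝ => 9 * (k : ℝ) ^ 2 / Real.sinh t ^ k * (k / Real.sqrt Λ))
      atTop (𝓝 0) := by
    simpa using hz.const_mul (9 * (k : ℝ) ^ 2 / Real.sinh t ^ k)
  have hsq : Tendsto (fun Λ => (Real.sqrt Λ * f Λ t) ^ 2) atTop (𝓝 0) := by
    refine squeeze_zero' (Eventually.of_forall fun _ => sq_nonneg _) ?_ h0
    filter_upwards [eventually_ge_atTop ((k : ℝ) ^ 2), hz.eventually (gt_mem_nhds hS),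
      eventually_gt_atTop 0] with Λ h1 h2 hΛ
    have h3 := (hf Λ hΛ).sinh_pow_mul_sq_le (by omega) ht h1 h2.le
    have hq0 := Real.sqrt_pos.2 hΛ
    have hle : k / Real.sqrt Λ ≤ 1 := (div_le_one hq0).2 (Real.le_sqrt_of_sq_le h1)
    -- Exponent `3` suffices: multiplying by `Λ` still leaves a factor `1 / √Λ`.
    have h4 : (k / Real.sqrt Λ) ^ k ≤ (k / Real.sqrt Λ) ^ 3 :=
      pow_le_pow_of_le_one (by positivity) hle hk
    have h5 : f Λ t ^ 2 ≤ 9 * (k / Real.sqrt Λ) ^ 3 / Real.sinh t ^ k := by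
      rw [le_div_iff₀ (by positivity)]
      linarith
    calc _ = Real.sqrt Λ ^ 2 * f Λ t ^ 2 := mul_pow _ _ _
      _ ≤ Real.sqrt Λ ^ 2 * (9 * (k / Real.sqrt Λ) ^ 3 / Real.sinh t ^ k) := by gcongr
      _ = _ := by field_simp
  have := hsq.sqrt
  simp only [Real.sqrt_sq_eq_abs, Real.sqrt_zero] at this
  exact (tendsto_zero_iff_abs_tendsto_zero _).2 this

/-! ### The case `k = 1`: the solution as an angular mean of plane waves. -/

/-- Differentiation under the integral sign for continuous integrands on a compact interval. -/
theorem hasDerivAt_intervalIntegral_of_continuous {F F' : ℝ → ℝ → ℂ}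
    (hF : Continuous (Function.uncurry F)) (hF' : Continuous (Function.uncurry F'))
    (hd : ∀ t x, HasDerivAt (fun s => F s x) (F' t x) t) (a b t : ℝ) :
    HasDerivAt (fun s => ∫ x in a..b, F s x) (∫ x in a..b, F' t x) t := by
  have hK : IsCompact (Set.Icc (t - 1) (t + 1) ×ˢ Set.uIcc a b) :=
    isCompact_Icc.prod isCompact_uIcc
  obtain ⟨C, hC⟩ := hK.exists_bound_of_continuousOn hF'.continuousOn
  have h1 : ∀ s, Continuous (F s) := fun s => hF.comp (by fun_prop : Continuous fun x => (s, x))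
  have h2 : ∀ s, Continuous (F' s) := fun s => hF'.comp (by fun_prop : Continuous fun x => (s, x))
  exact (intervalIntegral.hasDerivAt_integral_of_dominated_loc_of_deriv_le
    (F := F) (F' := F') (bound := fun _ => C)
    (Icc_mem_nhds (by linarith : t - 1 < t) (by linarith : t < t + 1))
    (Eventually.of_forall fun s => (h1 s).aestronglyMeasurable)
    ((h1 t).intervalIntegrable a b) (h2 t).aestronglyMeasurable
    (Eventually.of_forall fun x hx s hs => hC (s, x) ⟨hs, Set.uIoc_subset_uIcc hx⟩)
    (intervalIntegrable_const) (Eventually.of_forall fun x _ s _ => hd s x)).2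

/-- The exponential of the Busemann function of the hyperbolic plane in geodesic polar
coordinates. -/
noncomputable def horo (t x : ℝ) : ℝ := Real.cosh t + Real.sinh t * Real.cos x

/-- The derivative of `horo` in the radial variable. -/
noncomputable def horoDeriv (t x : ℝ) : ℝ := Real.sinh t + Real.cosh t * Real.cos x

theorem horo_pos (t x : ℝ) : 0 < horo t x := by
  have h1 := Real.cosh_sq t
  have h2 := Real.cosh_pos t
  have h3 : |Real.sinh t| < Real.cosh t := abs_lt_of_sq_lt_sq (by linarith) h2.le
  have h4 : |Real.sinh t * Real.cos x| ≤ |Real.sinh t| := by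
    rw [abs_mul]
    exact mul_le_of_le_one_right (abs_nonneg _) (Real.abs_cos_le_one x)
  have := neg_abs_le (Real.sinh t * Real.cos x)
  unfold horo
  linarith

theorem continuous_horo : Continuous (Function.uncurry horo) := by
  unfold horo Function.uncurry
  fun_prop

theorem continuous_horoDeriv : Continuous (Function.uncurry horoDeriv) := by
  unfold horoDeriv Function.uncurry
  fun_prop

theorem hasDerivAt_horo (t x : ℝ) : HasDerivAt (fun s => horo s x) (horoDeriv t x) t :=
  (Real.hasDerivAt_cosh t).add ((Real.hasDerivAt_sinh t).mul_const _)

theorem hasDerivAt_horoDeriv (t x : ℝ) : HasDerivAt (fun s => horoDeriv s x) (horo t x) t :=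
  (Real.hasDerivAt_sinh t).add ((Real.hasDerivAt_cosh t).mul_const _)

theorem hasDerivAt_horo_angle (t x : ℝ) :
    HasDerivAt (horo t) (-(Real.sinh t * Real.sin x)) x :=
  (((Real.hasDerivAt_cos x).const_mul (Real.sinh t)).const_add (Real.cosh t)).congr_deriv
    (by ring)

/-- The plane wave `horo ^ a`. -/
noncomputable def planeWave (a : ℂ) (t x : ℝ) : ℂ := Complex.exp (a * (Real.log (horo t x) : ℝ))

theorem continuous_planeWave (a : ℂ) : Continuous (Function.uncurry (planeWave a)) := by
  have : Continuous fun p : ℝ × ℝ => Real.log (horo p.1 p.2) :=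
    continuous_horo.log fun p => (horo_pos p.1 p.2).ne'
  unfold planeWave Function.uncurry
  fun_prop

theorem hasDerivAt_planeWave (a : ℂ) (t x : ℝ) :
    HasDerivAt (fun s => planeWave a s x)
      (a * (horoDeriv t x / horo t x : ℝ) * planeWave a t x) t := by
  have h := ((hasDerivAt_horo t x).log (horo_pos t x).ne').ofReal_comp
  refine ((h.const_mul a).cexp).congr_deriv ?_
  rw [planeWave, mul_comm]

theorem hasDerivAt_planeWave_angle (a : ℂ) (t x : ℝ) :
    HasDerivAt (planeWave a t)
      (a * (-(Real.sinh t * Real.sin x) / horo t x : ℝ) * planeWave a t x) x := by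
  have h := ((hasDerivAt_horo_angle t x).log (horo_pos t x).ne').ofReal_comp
  refine ((h.const_mul a).cexp).congr_deriv ?_
  rw [planeWave, mul_comm]

theorem hasDerivAt_planeWave_deriv (a : ℂ) (t x : ℝ) :
    HasDerivAt (fun s => a * (horoDeriv s x / horo s x : ℝ) * planeWave a s x)
      ((a * (1 - (horoDeriv t x / horo t x : ℝ) ^ 2) + a ^ 2 * (horoDeriv t x / horo t x : ℝ) ^ 2) *
        planeWave a t x) t := by
  have hne := (horo_pos t x).ne'
  have h1 := (((hasDerivAt_horoDeriv t x).div (hasDerivAt_horo t x) hne).ofReal_comp).const_mul a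
  refine (h1.mul (hasDerivAt_planeWave a t x)).congr_deriv ?_
  have hne' : (horo t x : ℂ) ≠ 0 := by exact_mod_cast hne
  simp only [Pi.div_apply]
  push_cast
  field_simp

/-- The plane wave is an eigenfunction of the full Laplacian `∂t² + coth t ∂t + sinh⁻² t ∂x²` with
eigenvalue `a (a + 1)`. So the radial part minus the eigenvalue term is the `x`-derivative of
`-sinh⁻² t ∂x` of the wave, which is the function differentiated here. -/
theorem hasDerivAt_planeWave_mul_sin (a : ℂ) {t : ℝ} (ht : t ≠ 0) (x : ℝ) :
    HasDerivAt (fun y => a / Real.sinh t * (planeWave a t y * (Real.sin y / horo t y : ℝ)))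
      ((a * (1 - (horoDeriv t x / horo t x : ℝ) ^ 2) +
          a ^ 2 * (horoDeriv t x / horo t x : ℝ) ^ 2) * planeWave a t x +
        (Real.cosh t / Real.sinh t : ℝ) *
          (a * (horoDeriv t x / horo t x : ℝ) * planeWave a t x) -
        a * (a + 1) * planeWave a t x) x := by
  have hne := (horo_pos t x).ne'
  have hs : Real.sinh t ≠ 0 := fun h => ht (Real.sinh_eq_zero.1 h)
  have h1 := ((Real.hasDerivAt_sin x).div (hasDerivAt_horo_angle t x) hne).ofReal_comp
  refine (((hasDerivAt_planeWave_angle a t x).mul h1).const_mul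
    (a / (Real.sinh t : ℂ))).congr_deriv ?_
  have hne' : (horo t x : ℂ) ≠ 0 := by exact_mod_cast hne
  have hs' : (Real.sinh t : ℂ) ≠ 0 := by exact_mod_cast hs
  have e1 : ((Real.cosh t : ℝ) : ℂ) ^ 2 = (Real.sinh t : ℂ) ^ 2 + 1 := by
    exact_mod_cast Real.cosh_sq t
  have e2 : ((Real.sin x : ℝ) : ℂ) ^ 2 = 1 - (Real.cos x : ℂ) ^ 2 := by
    exact_mod_cast Real.sin_sq x
  have e3 : (horo t x : ℂ) = Real.cosh t + Real.sinh t * Real.cos x := by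
    simp only [horo]; push_cast; rfl
  have e4 : (horoDeriv t x : ℂ) = Real.sinh t + Real.cosh t * Real.cos x := by
    simp only [horoDeriv]; push_cast; rfl
  simp only [Pi.div_apply, Complex.ofReal_div, Complex.ofReal_sub, Complex.ofReal_mul,
    Complex.ofReal_neg, Complex.ofReal_pow]
  generalize planeWave a t x = P at *
  generalize (horo t x : ℂ) = h at *
  generalize (horoDeriv t x : ℂ) = h' at *
  generalize ((Real.sinh t : ℝ) : ℂ) = S at *
  generalize ((Real.cosh t : ℝ) : ℂ) = C at *
  generalize ((Real.sin x : ℝ) : ℂ) = u at *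
  generalize ((Real.cos x : ℝ) : ℂ) = v at *
  have e5 : h' ^ 2 = h ^ 2 - u ^ 2 := by
    rw [e2, e3, e4]
    linear_combination (v ^ 2 - 1) * e1
  have e6 : C * h' = S * h + v := by
    rw [e3, e4]
    linear_combination v * e1
  field_simp
  linear_combination (a * P) * (S * (1 - a)) * e5 - a * P * h * e6

/-- Integrating the preceding identity over `[0, π]` kills the angular part, since `sin` vanishes at
both ends; the eigenvalue is `a (a + 1) = -(1 / 4 + b ^ 2)`. At `t = 0` the wave is constantly `1`,
whence the division by `π`. -/
theorem isRadialSolution_one (b : ℝ) :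
    ∃ f', IsRadialSolution 1 (1 / 4 + b ^ 2)
      (fun t => (∫ x in (0 : ℝ)..Real.pi, planeWave (-1 / 2 + b * Complex.I) t x).re / Real.pi)
      f' 1 := by
  set a : ℂ := -1 / 2 + b * Complex.I with ha
  have hc0 := continuous_planeWave a
  have hcq : Continuous fun p : ℝ × ℝ => horoDeriv p.1 p.2 / horo p.1 p.2 :=
    continuous_horoDeriv.div continuous_horo fun p => (horo_pos p.1 p.2).ne'
  have hc0' : Continuous fun p : ℝ × ℝ => planeWave a p.1 p.2 := hc0
  have hc1 : Continuous (Function.uncurry fun t x =>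
      a * (horoDeriv t x / horo t x : ℝ) * planeWave a t x) := by
    unfold Function.uncurry
    fun_prop
  have hc2 : Continuous (Function.uncurry fun t x =>
      (a * (1 - (horoDeriv t x / horo t x : ℝ) ^ 2) + a ^ 2 * (horoDeriv t x / horo t x : ℝ) ^ 2) *
        planeWave a t x) := by
    unfold Function.uncurry
    fun_prop
  have hd0 := fun t => hasDerivAt_intervalIntegral_of_continuous hc0 hc1
    (hasDerivAt_planeWave a) 0 Real.pi t
  have hd1 := fun t => hasDerivAt_intervalIntegral_of_continuous hc1 hc2
    (hasDerivAt_planeWave_deriv a) 0 Real.pi t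
  have hre : ∀ {g : ℝ → ℂ} {g' : ℂ} {t : ℝ}, HasDerivAt g g' t →
      HasDerivAt (fun s => (g s).re / Real.pi) (g'.re / Real.pi) t := fun h =>
    (Complex.reCLM.hasFDerivAt.comp_hasDerivAt _ h).div_const Real.pi
  refine ⟨_, fun t _ => hre (hd0 t), fun t ht => (hre (hd1 t)).congr_deriv ?_, ?_⟩
  · have hi : ∀ {F : ℝ → ℝ → ℂ}, Continuous (Function.uncurry F) →
        IntervalIntegrable (F t) MeasureTheory.volume 0 Real.pi := fun h =>
      (h.comp (by fun_prop : Continuous fun x : ℝ => (t, x))).intervalIntegrable _ _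
    have key := intervalIntegral.integral_eq_sub_of_hasDerivAt
      (fun x _ => hasDerivAt_planeWave_mul_sin a ht.ne' x)
      (((hi hc2).add ((hi hc1).const_mul _)).sub ((hi hc0).const_mul _))
    rw [intervalIntegral.integral_sub ((hi hc2).add ((hi hc1).const_mul _))
      ((hi hc0).const_mul _), intervalIntegral.integral_add (hi hc2) ((hi hc1).const_mul _),
      intervalIntegral.integral_const_mul, intervalIntegral.integral_const_mul] at key
    have haa : a * (a + 1) = ((-(1 / 4 + b ^ 2) : ℝ) : ℂ) := by
      rw [ha]
      push_cast
      linear_combination (b : ℂ) ^ 2 * Complex.I_sq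
    rw [haa] at key
    simp only [Real.sin_pi, Real.sin_zero, zero_div, Complex.ofReal_zero, mul_zero, sub_zero]
      at key
    have hkre := congrArg Complex.re key
    rw [Complex.sub_re, Complex.add_re, Complex.re_ofReal_mul, Complex.re_ofReal_mul,
      Complex.zero_re] at hkre
    rw [Nat.cast_one]
    linear_combination hkre / Real.pi
  · have h0 := (hre (hd0 0)).continuousAt.tendsto
    have h1 : ∫ x in (0 : ℝ)..Real.pi, planeWave a 0 x = Real.pi := by
      simp [planeWave, horo]
    rw [h1, Complex.ofReal_re, div_self Real.pi_ne_zero] at h0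
    exact h0.mono_left nhdsWithin_le_nhds

/-! ### Fresnel integrals. -/

theorem norm_cexp_neg_mul_sq_le {c : ℂ} (hre : 0 ≤ c.re) (u : ℝ) :
    ‖Complex.exp (-c * (u : ℂ) ^ 2)‖ ≤ 1 := by
  rw [Complex.norm_exp, ← Complex.ofReal_pow, Complex.re_mul_ofReal, Complex.neg_re]
  exact Real.exp_le_one_iff.2 (by nlinarith [sq_nonneg u])

theorem continuous_cexp_neg_mul_sq (c : ℂ) :
    Continuous fun u : ℝ => Complex.exp (-c * (u : ℂ) ^ 2) := by
  fun_prop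

/-- Integration by parts with the primitive `-exp (-c u ^ 2) / (2 c u)`. The bound is uniform down
to `c.re = 0`, which allows passing from Gaussian to Fresnel integrals. -/
theorem norm_integral_cexp_neg_mul_sq_le {c : ℂ} (hre : 0 ≤ c.re) (hc : 1 ≤ ‖c‖) {R S : ℝ}
    (hR : 0 < R) (hRS : R ≤ S) :
    ‖∫ u in R..S, Complex.exp (-c * (u : ℂ) ^ 2)‖ ≤ 1 / R := by
  have hc0 : c ≠ 0 := norm_pos_iff.1 (by linarith)
  have hpos : ∀ u ∈ Set.uIcc R S, 0 < u := fun u hu => by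
    rw [Set.uIcc_of_le hRS] at hu
    exact hR.trans_le hu.1
  have hcont := continuous_cexp_neg_mul_sq c
  have hint2 : IntervalIntegrable
      (fun u : ℝ => Complex.exp (-c * (u : ℂ) ^ 2) / (2 * c * (u : ℂ) ^ 2))
      MeasureTheory.volume R S := by
    refine ContinuousOn.intervalIntegrable (hcont.continuousOn.div (by fun_prop) fun u hu => ?_)
    have := (hpos u hu).ne'
    simp [hc0, this]
  have hFTC := intervalIntegral.integral_eq_sub_of_hasDerivAt (a := R) (b := S)
    (f := fun u : ℝ => -(Complex.exp (-c * (u : ℂ) ^ 2) / (2 * c * (u : ℂ))))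
    (f' := fun u : ℝ => Complex.exp (-c * (u : ℂ) ^ 2) +
      Complex.exp (-c * (u : ℂ) ^ 2) / (2 * c * (u : ℂ) ^ 2))
    (fun u hu => by
      have hu0 := (hpos u hu).ne'
      have hu1 : (u : ℂ) ≠ 0 := by exact_mod_cast hu0
      have h1 : HasDerivAt (fun z : ℂ => -(Complex.exp (-c * z ^ 2) / (2 * c * z)))
          (Complex.exp (-c * (u : ℂ) ^ 2) +
            Complex.exp (-c * (u : ℂ) ^ 2) / (2 * c * (u : ℂ) ^ 2)) (u : ℂ) := by
        refine (((((hasDerivAt_pow 2 (u : ℂ)).const_mul (-c)).cexp).div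
          ((hasDerivAt_id (u : ℂ)).const_mul (2 * c)) (by simp [hc0, hu1])).neg).congr_deriv ?_
        simp only [id]
        push_cast
        field_simp
        ring
      exact h1.comp_ofReal)
    ((hcont.intervalIntegrable _ _).add hint2)
  rw [intervalIntegral.integral_add (hcont.intervalIntegrable _ _) hint2] at hFTC
  have hS : 0 < S := hR.trans_le hRS
  have hG : ∀ u : ℝ, 0 < u → ‖Complex.exp (-c * (u : ℂ) ^ 2) / (2 * c * (u : ℂ))‖ ≤
      1 / (2 * u) := fun u hu => by
    rw [norm_div, norm_mul, norm_mul, Complex.norm_real, Real.norm_of_nonneg hu.le,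
      Complex.norm_ofNat]
    gcongr
    · exact norm_cexp_neg_mul_sq_le hre u
    · linarith
  have hI2 : ∫ u in R..S, 1 / (2 * u ^ 2) = 1 / (2 * R) - 1 / (2 * S) := by
    have h := intervalIntegral.integral_eq_sub_of_hasDerivAt (a := R) (b := S)
      (f := fun u : ℝ => -(1 / (2 * u))) (f' := fun u : ℝ => 1 / (2 * u ^ 2)) (fun u hu => ?_) ?_
    · rw [h]
      ring
    · have := (hpos u hu).ne'
      refine (((hasDerivAt_const u (1 : ℝ)).div ((hasDerivAt_id u).const_mul 2)
        (by simpa using this)).neg).congr_deriv ?_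
      simp only [id]
      field_simp
      ring
    · refine ContinuousOn.intervalIntegrable (continuousOn_const.div (by fun_prop) fun u hu => ?_)
      have := hpos u hu
      positivity
  have hB : ‖∫ u in R..S, Complex.exp (-c * (u : ℂ) ^ 2) / (2 * c * (u : ℂ) ^ 2)‖ ≤
      1 / (2 * R) - 1 / (2 * S) := by
    rw [← hI2]
    refine intervalIntegral.norm_integral_le_of_norm_le hRS
      (Eventually.of_forall fun u hu => ?_) ?_
    · have hu0 : 0 < u := hR.trans hu.1
      rw [norm_div, norm_mul, norm_mul, norm_pow, Complex.norm_real, Real.norm_of_nonneg hu0.le,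
        Complex.norm_ofNat]
      gcongr
      · exact norm_cexp_neg_mul_sq_le hre u
      · linarith
    · refine ContinuousOn.intervalIntegrable (continuousOn_const.div (by fun_prop) fun u hu => ?_)
      have := hpos u hu
      positivity
  have h1 := hG R hR
  have h2 := hG S hS
  rw [eq_sub_of_add_eq hFTC]
  calc _ ≤ 1 / (2 * S) + 1 / (2 * R) + (1 / (2 * R) - 1 / (2 * S)) := by
        refine (norm_sub_le _ _).trans (add_le_add ((norm_sub_le _ _).trans ?_) hB)
        rw [norm_neg, norm_neg]
        exact add_le_add h2 h1
    _ = 1 / R := by field_simp; ring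

/-- The Fresnel integral from `0` to `R`. -/
noncomputable def fresnel (R : ℝ) : ℂ :=
  ∫ u in (0 : ℝ)..R, Complex.exp (-Complex.I * (u : ℂ) ^ 2)

/-- The complete Fresnel integral. -/
noncomputable def fresnelLimit : ℂ := (Real.pi / Complex.I) ^ (1 / 2 : ℂ) / 2

/-- For `c = ε + i` the complete integral is Gaussian and its tail is at most `1 / R` uniformly in
`ε`; then `ε → 0`. -/
theorem norm_fresnelLimit_sub_le {R : ℝ} (hR : 0 < R) : ‖fresnelLimit - fresnel R‖ ≤ 1 / R := by
  have hre : ∀ ε : ℝ, ((ε : ℂ) + Complex.I).re = ε := fun ε => by simp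
  have hε : ∀ ε : ℝ, 0 < ε → ‖(Real.pi / (ε + Complex.I)) ^ (1 / 2 : ℂ) / 2 -
      ∫ u in (0 : ℝ)..R, Complex.exp (-(ε + Complex.I) * (u : ℂ) ^ 2)‖ ≤ 1 / R := by
    intro ε hε
    have hc : 0 < ((ε : ℂ) + Complex.I).re := by rw [hre]; exact hε
    have hn : 1 ≤ ‖(ε : ℂ) + Complex.I‖ := by
      have := Complex.abs_im_le_norm ((ε : ℂ) + Complex.I)
      simpa using this
    have hcont := continuous_cexp_neg_mul_sq ((ε : ℂ) + Complex.I)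
    rw [← integral_gaussian_complex_Ioi hc]
    have hlim := (MeasureTheory.intervalIntegral_tendsto_integral_Ioi 0
      (integrable_cexp_neg_mul_sq hc).integrableOn tendsto_id).sub_const
      (∫ u in (0 : ℝ)..R, Complex.exp (-(ε + Complex.I) * (u : ℂ) ^ 2))
    refine le_of_tendsto hlim.norm ?_
    filter_upwards [eventually_ge_atTop R] with S hS
    rw [id, intervalIntegral.integral_interval_sub_left (hcont.intervalIntegrable _ _)
      (hcont.intervalIntegrable _ _)]
    exact norm_integral_cexp_neg_mul_sq_le hc.le hn hR hS
  have hz : Tendsto (fun ε : ℝ => (ε : ℂ) + Complex.I) (𝓝[>] 0) (𝓝 Complex.I) := by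
    have : Continuous fun ε : ℝ => (ε : ℂ) + Complex.I := by fun_prop
    simpa using (this.tendsto 0).mono_left (nhdsWithin_le_nhds (s := Set.Ioi 0))
  have h1 : Tendsto (fun ε : ℝ => ((Real.pi : ℂ) / (ε + Complex.I)) ^ (1 / 2 : ℂ) / 2) (𝓝[>] 0)
      (𝓝 fresnelLimit) := by
    refine Tendsto.div_const (Tendsto.comp (g := fun z : ℂ => z ^ (1 / 2 : ℂ)) ?_
      (tendsto_const_nhds.div hz Complex.I_ne_zero)) 2
    refine (continuousAt_cpow_const ?_).tendsto
    -- `π / i = -π i` lies off the cut, so the principal square root is continuous there.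
    rw [Complex.div_I, Complex.mem_slitPlane_iff]
    right
    simp [Real.pi_ne_zero]
  have h2 : Tendsto (fun ε : ℝ => ∫ u in (0 : ℝ)..R,
      Complex.exp (-(ε + Complex.I) * (u : ℂ) ^ 2)) (𝓝[>] 0) (𝓝 (fresnel R)) := by
    refine intervalIntegral.tendsto_integral_filter_of_dominated_convergence (fun _ => 1)
      (Eventually.of_forall fun ε => (continuous_cexp_neg_mul_sq _).aestronglyMeasurable) ?_
      intervalIntegrable_const (Eventually.of_forall fun u _ => ?_)
    · filter_upwards [self_mem_nhdsWithin] with ε hε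
      have hε : 0 < ε := hε
      exact Eventually.of_forall fun u _ => norm_cexp_neg_mul_sq_le (by rw [hre]; exact hε.le) u
    · exact ((hz.neg).mul_const _).cexp
  refine le_of_tendsto (h1.sub h2).norm ?_
  filter_upwards [self_mem_nhdsWithin] with ε h
  exact hε ε h

theorem tendsto_fresnel : Tendsto fresnel atTop (𝓝 fresnelLimit) := by
  have h : Tendsto (fun R : ℝ => 1 / R) atTop (𝓝 0) := tendsto_const_nhds.div_atTop tendsto_id
  have h1 : Tendsto (fun R => fresnelLimit - fresnel R) atTop (𝓝 0) := by
    refine squeeze_zero_norm' ?_ h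
    filter_upwards [eventually_gt_atTop 0] with R hR
    exact norm_fresnelLimit_sub_le hR
  simpa using h1.const_sub fresnelLimit

theorem norm_fresnel_le {R : ℝ} (hR : 0 ≤ R) : ‖fresnel R‖ ≤ ‖fresnelLimit‖ + 1 := by
  rcases le_total R 1 with h | h
  · have := intervalIntegral.norm_integral_le_of_norm_le_const (a := 0) (b := R) (C := 1)
      (f := fun u : ℝ => Complex.exp (-Complex.I * (u : ℂ) ^ 2))
      fun u _ => norm_cexp_neg_mul_sq_le (by simp) u
    rw [sub_zero, abs_of_nonneg hR, one_mul] at this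
    have := norm_nonneg fresnelLimit
    unfold fresnel
    linarith
  · have h1 := norm_fresnelLimit_sub_le (zero_lt_one.trans_le h)
    have h2 : 1 / R ≤ 1 := (div_le_one (by linarith)).2 h
    have h3 := norm_sub_norm_le (fresnel R) fresnelLimit
    rw [norm_sub_rev] at h3
    linarith

theorem hasDerivAt_fresnel (R : ℝ) :
    HasDerivAt fresnel (Complex.exp (-Complex.I * (R : ℂ) ^ 2)) R :=
  (continuous_cexp_neg_mul_sq _).integral_hasStrictDerivAt 0 R |>.hasDerivAt

theorem continuous_fresnel : Continuous fresnel :=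
  continuous_iff_continuousAt.2 fun R => (hasDerivAt_fresnel R).continuousAt

theorem fresnelLimit_eq :
    fresnelLimit = (Real.sqrt Real.pi / 2 : ℝ) * Complex.exp (-(Real.pi / 4 : ℝ) * Complex.I) := by
  have hπ := Real.pi_pos
  have hne : (Real.pi : ℂ) ≠ 0 := by exact_mod_cast hπ.ne'
  have hsq : ((Real.sqrt Real.pi : ℝ) : ℂ) = Complex.exp (1 / 2 * (Real.log Real.pi : ℝ)) := by
    rw [Real.sqrt_eq_rpow, Real.rpow_def_of_pos hπ]
    push_cast
    congr 1
    ring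
  rw [fresnelLimit, Complex.div_I, ← mul_neg, Complex.cpow_def_of_ne_zero (by simp [hne]),
    Complex.log_ofReal_mul hπ (by simp), Complex.log_neg_I]
  push_cast
  rw [hsq, div_mul_eq_mul_div, ← Complex.exp_add]
  congr 2
  ring

/-! ### Oscillatory integrals with an endpoint singularity. -/

/-- Leading term of an oscillatory integral with an inverse square root singularity at an
endpoint. -/
theorem tendsto_sqrt_mul_integral_cexp_div_sqrt {t : ℝ} (ht : 0 < t) {q q' : ℝ → ℝ}
    (hq : ContinuousOn q (Set.Icc 0 t)) (hd : ∀ x ∈ Set.Ioo 0 t, HasDerivAt q (q' x) x)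
    (hi : IntervalIntegrable q' MeasureTheory.volume 0 t) :
    Tendsto (fun b : ℝ => (Real.sqrt b : ℂ) * ∫ x in (0 : ℝ)..t,
        (q x : ℂ) * (Complex.exp (-Complex.I * (b * x : ℝ)) / (Real.sqrt x : ℝ)))
      atTop (𝓝 (2 * fresnelLimit * q 0)) := by
  have hu : Set.uIcc 0 t = Set.Icc 0 t := Set.uIcc_of_le ht.le
  have hcq : ContinuousOn (fun x => (q x : ℂ)) (Set.uIcc 0 t) := by
    rw [hu]; exact Complex.continuous_ofReal.comp_continuousOn hq
  have hIoo : Set.Ioo (min 0 t) (max 0 t) = Set.Ioo 0 t := by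
    rw [min_eq_left ht.le, max_eq_right ht.le]
  have hd' : ∀ x ∈ Set.Ioo (min 0 t) (max 0 t), HasDerivAt (fun x => (q x : ℂ)) (q' x : ℂ) x := by
    rw [hIoo]; exact fun x hx => (hd x hx).ofReal_comp
  have hi' : IntervalIntegrable (fun x => (q' x : ℂ)) MeasureTheory.volume 0 t :=
    ⟨MeasureTheory.Integrable.ofReal hi.1, MeasureTheory.Integrable.ofReal hi.2⟩
  -- Integration by parts: the substitution `u = √(b x)` shows that `2 / √b * fresnel (√(b x))` is a
  -- primitive of `exp (-i b x) / √x`, and it vanishes at `0`.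
  have hparts : ∀ b : ℝ, 0 < b → (Real.sqrt b : ℂ) * ∫ x in (0 : ℝ)..t,
        (q x : ℂ) * (Complex.exp (-Complex.I * (b * x : ℝ)) / (Real.sqrt x : ℝ)) =
      2 * (q t * fresnel (Real.sqrt (b * t)) -
        ∫ x in (0 : ℝ)..t, (q' x : ℂ) * fresnel (Real.sqrt (b * x))) := by
    intro b hb
    have hsb := Real.sqrt_pos.2 hb
    have hsb' : (Real.sqrt b : ℂ) ≠ 0 := by exact_mod_cast hsb.ne'
    have hv : ∀ x ∈ Set.Ioo (min 0 t) (max 0 t), HasDerivAt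
        (fun x => 2 / (Real.sqrt b : ℂ) * fresnel (Real.sqrt (b * x)))
        (Complex.exp (-Complex.I * (b * x : ℝ)) / (Real.sqrt x : ℝ)) x := by
      rw [hIoo]
      intro x hx
      have hx0 : 0 < x := hx.1
      have hbx : 0 < b * x := mul_pos hb hx0
      have hsx := Real.sqrt_pos.2 hx0
      have h1 : HasDerivAt (fun x => Real.sqrt (b * x)) (b * 1 / (2 * Real.sqrt (b * x))) x :=
        ((hasDerivAt_id x).const_mul b).sqrt hbx.ne'
      refine (((hasDerivAt_fresnel _).scomp x h1).const_mul
        (2 / (Real.sqrt b : ℂ))).congr_deriv ?_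
      rw [← Complex.ofReal_pow, Real.sq_sqrt hbx.le, Complex.real_smul, Real.sqrt_mul hb.le]
      have hsx' : (Real.sqrt x : ℂ) ≠ 0 := by exact_mod_cast hsx.ne'
      have hbb : (b : ℂ) = (Real.sqrt b : ℂ) ^ 2 := by
        exact_mod_cast (Real.sq_sqrt hb.le).symm
      push_cast
      rw [show ((b : ℂ) * 1 / (2 * (Real.sqrt b * Real.sqrt x))) =
        (Real.sqrt b : ℂ) / (2 * Real.sqrt x) by rw [hbb]; field_simp]
      field_simp
    have hvc : ContinuousOn (fun x => 2 / (Real.sqrt b : ℂ) * fresnel (Real.sqrt (b * x)))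
        (Set.uIcc 0 t) := by
      have := continuous_fresnel
      fun_prop
    have hvi : IntervalIntegrable
        (fun x : ℝ => Complex.exp (-Complex.I * (b * x : ℝ)) / (Real.sqrt x : ℝ))
        MeasureTheory.volume 0 t := by
      have h1 : IntervalIntegrable (fun x : ℝ => ((x ^ (-(1 / 2) : ℝ) : ℝ) : ℂ))
          MeasureTheory.volume 0 t := by
        have h : IntervalIntegrable (fun x : ℝ => x ^ (-(1 / 2) : ℝ)) MeasureTheory.volume 0 t :=
          intervalIntegral.intervalIntegrable_rpow' (by norm_num)
        exact ⟨MeasureTheory.Integrable.ofReal h.1, MeasureTheory.Integrable.ofReal h.2⟩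
      have h2 := h1.continuousOn_mul
        (g := fun x : ℝ => Complex.exp (-Complex.I * (b * x : ℝ))) (by fun_prop)
      refine h2.congr_ae ?_
      rw [Filter.EventuallyEq, MeasureTheory.ae_restrict_iff' measurableSet_uIoc]
      refine Eventually.of_forall fun x hx => ?_
      rw [Set.uIoc_of_le ht.le] at hx
      rw [Real.rpow_neg hx.1.le, ← Real.sqrt_eq_rpow, Complex.ofReal_inv, div_eq_mul_inv]
    rw [intervalIntegral.integral_mul_deriv_eq_deriv_mul_of_hasDerivAt hcq hvc hd' hv hi' hvi]
    have h0 : fresnel (Real.sqrt (b * 0)) = 0 := by simp [fresnel]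
    have h3 : ∫ x in (0 : ℝ)..t, (q' x : ℂ) * (2 / (Real.sqrt b : ℂ) * fresnel (Real.sqrt (b * x)))
        = 2 / (Real.sqrt b : ℂ) * ∫ x in (0 : ℝ)..t, (q' x : ℂ) * fresnel (Real.sqrt (b * x)) := by
      rw [← intervalIntegral.integral_const_mul]
      exact intervalIntegral.integral_congr fun x _ => by ring
    rw [h0, h3]
    field_simp
    ring
  have hsc : ∀ x, 0 < x → Tendsto (fun b : ℝ => fresnel (Real.sqrt (b * x))) atTop
      (𝓝 fresnelLimit) := fun x hx =>
    tendsto_fresnel.comp (Real.tendsto_sqrt_atTop.comp (tendsto_id.atTop_mul_const hx))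
  have hdom : Tendsto (fun b : ℝ => ∫ x in (0 : ℝ)..t, (q' x : ℂ) * fresnel (Real.sqrt (b * x)))
      atTop (𝓝 (∫ x in (0 : ℝ)..t, (q' x : ℂ) * fresnelLimit)) := by
    refine intervalIntegral.tendsto_integral_filter_of_dominated_convergence
      (fun x => ‖(q' x : ℂ)‖ * (‖fresnelLimit‖ + 1)) (Eventually.of_forall fun b => ?_)
      (Eventually.of_forall fun b => Eventually.of_forall fun x _ => ?_)
      (hi'.norm.mul_const _) (Eventually.of_forall fun x hx => ?_)
    · refine hi'.aestronglyMeasurable_restrict_uIoc.mul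
        (Continuous.aestronglyMeasurable ?_)
      have := continuous_fresnel
      fun_prop
    · rw [norm_mul]
      gcongr
      exact norm_fresnel_le (Real.sqrt_nonneg _)
    · rw [Set.uIoc_of_le ht.le] at hx
      exact (hsc x hx.1).const_mul _
  have hFTC : ∫ x in (0 : ℝ)..t, (q' x : ℂ) = q t - q 0 := by
    have := intervalIntegral.integral_eq_sub_of_hasDerivAt_of_le ht.le (hu ▸ hcq)
      (hIoo ▸ hd') hi'
    exact this
  rw [intervalIntegral.integral_mul_const, hFTC] at hdom
  -- In the limit `fresnel` becomes constant, the contributions of `q t` cancel, and only `q 0`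
  -- remains.
  have hfin := (((hsc t ht).const_mul (q t : ℂ)).sub hdom).const_mul 2
  rw [show 2 * ((q t : ℂ) * fresnelLimit - (q t - q 0) * fresnelLimit) =
    2 * fresnelLimit * q 0 by ring] at hfin
  refine hfin.congr' ?_
  filter_upwards [eventually_gt_atTop 0] with b hb
  exact (hparts b hb).symm

/-- Twice the slope of `cosh` between `t` and `t - x`. -/
noncomputable def coshSlope (t x : ℝ) : ℝ := 2 * dslope Real.cosh t (t - x)

theorem coshSlope_of_ne (t : ℝ) {x : ℝ} (hx : x ≠ 0) :
    coshSlope t x = (2 * Real.cosh t - 2 * Real.cosh (t - x)) / x := by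
  rw [coshSlope, dslope_of_ne _ (by simpa using hx), slope_def_field,
    sub_sub_cancel_left, div_neg]
  ring

theorem coshSlope_zero (t : ℝ) : coshSlope t 0 = 2 * Real.sinh t := by
  rw [coshSlope, sub_zero, dslope_same, (Real.hasDerivAt_cosh t).deriv]

theorem continuous_coshSlope (t : ℝ) : Continuous (coshSlope t) := by
  have h : Continuous (dslope Real.cosh t) := by
    rw [← continuousOn_univ, continuousOn_dslope univ_mem]
    exact ⟨Real.continuous_cosh.continuousOn, Real.differentiableAt_cosh⟩
  exact continuous_const.mul (h.comp (by fun_prop))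

theorem coshSlope_pos {t x : ℝ} (ht : 0 < t) (hx : x ∈ Set.Icc 0 t) : 0 < coshSlope t x := by
  rcases eq_or_lt_of_le hx.1 with h | h
  · rw [← h, coshSlope_zero]
    have := Real.sinh_pos_iff.2 ht
    positivity
  · rw [coshSlope_of_ne t h.ne']
    have : Real.cosh (t - x) < Real.cosh t := by
      rw [Real.cosh_lt_cosh, abs_of_nonneg (sub_nonneg.2 hx.2), abs_of_pos ht]
      linarith
    exact div_pos (by linarith) h

theorem hasDerivAt_coshSlope (t : ℝ) {x : ℝ} (hx : 0 < x) :
    HasDerivAt (coshSlope t)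
      (-(2 * (Real.cosh t - Real.cosh (t - x) - x * Real.sinh (t - x)) / x ^ 2)) x := by
  have h : HasDerivAt (fun y => (2 * Real.cosh t - 2 * Real.cosh (t - y)) / y)
      (-(2 * (Real.cosh t - Real.cosh (t - x) - x * Real.sinh (t - x)) / x ^ 2)) x := by
    refine (((((hasDerivAt_id x).const_sub t).cosh.const_mul 2).const_sub
      (2 * Real.cosh t)).div (hasDerivAt_id x) hx.ne').congr_deriv ?_
    simp only [id]
    field_simp
    ring
  refine h.congr_of_eventuallyEq ?_
  filter_upwards [Ioi_mem_nhds hx] with y hy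
  exact coshSlope_of_ne t (ne_of_gt hy)

/-- Convexity of `cosh`. It makes `coshSlope t` decreasing, so that the derivative of its inverse
square root is nonnegative and therefore integrable. -/
theorem mul_sinh_le_cosh_sub_cosh {t x : ℝ} (hx : 0 < x) :
    x * Real.sinh (t - x) ≤ Real.cosh t - Real.cosh (t - x) := by
  obtain ⟨y, hy, h⟩ := exists_hasDerivAt_eq_slope Real.cosh Real.sinh (show t - x < t by linarith)
    Real.continuous_cosh.continuousOn fun z _ => Real.hasDerivAt_cosh z
  have h1 := Real.sinh_le_sinh.2 hy.1.le
  rw [eq_div_iff (by linarith)] at h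
  rw [← h]
  nlinarith

/-- Leading term of the oscillatory integral in the Mehler–Dirichlet formula. -/
theorem tendsto_sqrt_mul_integral_coshSlope {t : ℝ} (ht : 0 < t) :
    Tendsto (fun b : ℝ => (Real.sqrt b : ℂ) * ∫ x in (0 : ℝ)..t,
        ((Real.sqrt (coshSlope t x))⁻¹ : ℝ) *
          (Complex.exp (-Complex.I * (b * x : ℝ)) / (Real.sqrt x : ℝ)))
      atTop (𝓝 (2 * fresnelLimit * ((Real.sqrt (2 * Real.sinh t))⁻¹ : ℝ))) := by
  have hcont : ContinuousOn (fun x => (Real.sqrt (coshSlope t x))⁻¹) (Set.Icc 0 t) :=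
    (continuous_coshSlope t).sqrt.continuousOn.inv₀ fun x hx =>
      (Real.sqrt_pos.2 (coshSlope_pos ht hx)).ne'
  have hd : ∀ x ∈ Set.Ioo 0 t, HasDerivAt (fun x => (Real.sqrt (coshSlope t x))⁻¹)
      (-(-(2 * (Real.cosh t - Real.cosh (t - x) - x * Real.sinh (t - x)) / x ^ 2) /
        (2 * Real.sqrt (coshSlope t x))) / Real.sqrt (coshSlope t x) ^ 2) x := fun x hx => by
    have hp := coshSlope_pos ht (Set.Ioo_subset_Icc_self hx)
    exact ((hasDerivAt_coshSlope t hx.1).sqrt hp.ne').inv (Real.sqrt_pos.2 hp).ne'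
  have hi := intervalIntegral.intervalIntegrable_deriv_of_nonneg (a := 0) (b := t)
    (by rwa [Set.uIcc_of_le ht.le]) (by rwa [min_eq_left ht.le, max_eq_right ht.le])
    (by
      rw [min_eq_left ht.le, max_eq_right ht.le]
      intro x hx
      have := mul_sinh_le_cosh_sub_cosh (t := t) hx.1
      have : 0 ≤ Real.cosh t - Real.cosh (t - x) - x * Real.sinh (t - x) := by linarith
      rw [neg_div, neg_div, neg_div, neg_neg]
      positivity)
  have h := tendsto_sqrt_mul_integral_cexp_div_sqrt ht hcont hd hi
  rwa [coshSlope_zero] at h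

/-! ### The Mehler–Dirichlet formula and the asymptotics for `k = 1`. -/

theorem planeWave_re (b t x : ℝ) :
    (planeWave (-1 / 2 + b * Complex.I) t x).re =
      (Real.sqrt (horo t x))⁻¹ * Real.cos (b * Real.log (horo t x)) := by
  have h : (-1 / 2 + b * Complex.I) * (Real.log (horo t x) : ℝ) =
      ((-(1 / 2) * Real.log (horo t x) : ℝ) : ℂ) +
        ((b * Real.log (horo t x) : ℝ) : ℂ) * Complex.I := by
    push_cast
    ring
  rw [planeWave, h, Complex.exp_re]
  simp only [Complex.add_re, Complex.ofReal_re, Complex.re_ofReal_mul, Complex.I_re, mul_zero,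
    add_zero, Complex.add_im, Complex.ofReal_im, Complex.im_ofReal_mul, Complex.I_im, mul_one,
    zero_add]
  rw [Real.sqrt_eq_rpow, ← Real.rpow_neg (horo_pos t x).le, Real.rpow_def_of_pos (horo_pos t x),
    mul_comm (Real.log _)]

theorem strictAntiOn_log_horo {t : ℝ} (ht : 0 < t) :
    StrictAntiOn (fun x => Real.log (horo t x)) (Set.Icc 0 Real.pi) := fun x hx y hy hxy => by
  refine Real.log_lt_log (horo_pos t y) ?_
  have := Real.strictAntiOn_cos hx hy hxy
  have := Real.sinh_pos_iff.2 ht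
  unfold horo
  gcongr

theorem image_log_horo {t : ℝ} (ht : 0 < t) :
    (fun x => Real.log (horo t x)) '' Set.Ioo 0 Real.pi = Set.Ioo (-t) t := by
  have h0 : Real.log (horo t 0) = t := by
    rw [horo, Real.cos_zero, mul_one, Real.cosh_add_sinh, Real.log_exp]
  have hπ : Real.log (horo t Real.pi) = -t := by
    rw [horo, Real.cos_pi, mul_neg_one, ← sub_eq_add_neg, Real.cosh_sub_sinh, Real.log_exp]
  have hanti := strictAntiOn_log_horo ht
  refine Set.Subset.antisymm ?_ ?_
  · rintro _ ⟨x, hx, rfl⟩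
    have hx' := Set.Ioo_subset_Icc_self hx
    constructor
    · rw [← hπ]
      exact hanti hx' (Set.right_mem_Icc.2 Real.pi_pos.le) hx.2
    · have := hanti (Set.left_mem_Icc.2 Real.pi_pos.le) hx' hx.1
      simp only [h0] at this
      exact this
  · have hc : ContinuousOn (fun x => Real.log (horo t x)) (Set.Icc 0 Real.pi) := fun x _ =>
      ((hasDerivAt_horo_angle t x).log (horo_pos t x).ne').continuousAt.continuousWithinAt
    have := intermediate_value_Ioo' Real.pi_pos.le hc
    rwa [h0, hπ] at this

/-- The Mehler–Dirichlet formula. -/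
theorem integral_planeWave_re {t : ℝ} (ht : 0 < t) (b : ℝ) :
    (∫ x in (0 : ℝ)..Real.pi, planeWave (-1 / 2 + b * Complex.I) t x).re =
      2 * ∫ s in (0 : ℝ)..t,
        Real.cos (b * s) * (Real.sqrt (2 * Real.cosh t - 2 * Real.cosh s))⁻¹ := by
  have hi : IntervalIntegrable (planeWave (-1 / 2 + b * Complex.I) t) MeasureTheory.volume
      0 Real.pi := ((continuous_planeWave _).comp
        (by fun_prop : Continuous fun x : ℝ => (t, x))).intervalIntegrable _ _
  have hS := Real.sinh_pos_iff.2 ht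
  have h1 : (∫ x in (0 : ℝ)..Real.pi, planeWave (-1 / 2 + b * Complex.I) t x).re =
      ∫ x in (0 : ℝ)..Real.pi, (planeWave (-1 / 2 + b * Complex.I) t x).re :=
    (Complex.reCLM.intervalIntegral_comp_comm hi).symm
  have h2 := MeasureTheory.integral_image_eq_integral_abs_deriv_smul
    (measurableSet_Ioo (a := (0 : ℝ)) (b := Real.pi))
    (fun x _ => ((hasDerivAt_horo_angle t x).log (horo_pos t x).ne').hasDerivWithinAt)
    ((strictAntiOn_log_horo ht).injOn.mono Set.Ioo_subset_Icc_self)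
    (fun s => Real.cos (b * s) * (Real.sqrt (2 * Real.cosh t - 2 * Real.cosh s))⁻¹)
  rw [image_log_horo ht] at h2
  have h3 : ∫ x in Set.Ioo 0 Real.pi, |-(Real.sinh t * Real.sin x) / horo t x| •
      (Real.cos (b * Real.log (horo t x)) *
        (Real.sqrt (2 * Real.cosh t - 2 * Real.cosh (Real.log (horo t x))))⁻¹) =
      ∫ x in Set.Ioo 0 Real.pi, (planeWave (-1 / 2 + b * Complex.I) t x).re := by
    refine MeasureTheory.setIntegral_congr_fun measurableSet_Ioo fun x hx => ?_
    have hp := horo_pos t x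
    have hsin := Real.sin_pos_of_pos_of_lt_pi hx.1 hx.2
    have hsq := Real.sqrt_pos.2 hp
    simp only [planeWave_re]
    -- With `s = log (horo t x)` this identity turns the Jacobian `sinh t * sin x / horo` times the
    -- inverse square root into `horo ^ (-1 / 2)`.
    have e1 : 2 * Real.cosh t - 2 * Real.cosh (Real.log (horo t x)) =
        (Real.sinh t * Real.sin x) ^ 2 / horo t x := by
      rw [Real.cosh_log hp, mul_pow, Real.sin_sq, eq_div_iff hp.ne']
      field_simp
      unfold horo
      linear_combination (Real.cosh_sq t)
    rw [e1, Real.sqrt_div (sq_nonneg _), Real.sqrt_sq (by positivity), neg_div, abs_neg,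
      abs_of_pos (by positivity), smul_eq_mul]
    have := Real.sq_sqrt hp.le
    field_simp
    linear_combination Real.cos (b * Real.log (horo t x)) * this
  -- The integrand is even, hence a function of `|s|`; `integral_comp_abs` then folds the integral
  -- onto `(0, t)`.
  have h4 : ∫ s in Set.Ioo (-t) t,
      Real.cos (b * s) * (Real.sqrt (2 * Real.cosh t - 2 * Real.cosh s))⁻¹ =
      ∫ s, (Set.Iio t).indicator (fun s =>
        Real.cos (b * s) * (Real.sqrt (2 * Real.cosh t - 2 * Real.cosh s))⁻¹) |s| := by
    rw [← MeasureTheory.integral_indicator measurableSet_Ioo]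
    congr 1
    ext s
    simp only [Set.indicator, Set.mem_Ioo, Set.mem_Iio, abs_lt]
    congr 1
    rw [Real.cosh_abs]
    rcases abs_choice s with h | h <;> rw [h]
    rw [mul_neg, Real.cos_neg]
  rw [h1, intervalIntegral.integral_of_le Real.pi_pos.le,
    MeasureTheory.integral_Ioc_eq_integral_Ioo, ← h3, ← h2, h4, integral_comp_abs,
    intervalIntegral.integral_of_le ht.le, MeasureTheory.integral_Ioc_eq_integral_Ioo,
    MeasureTheory.setIntegral_indicator measurableSet_Iio, Set.Ioi_inter_Iio]

/-- The substitution `x = t - s` moves the singularity to `0`, and `2 cosh t - 2 cosh (t - x) = x *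
coshSlope t x` isolates the factor `1 / √x`. -/
theorem integral_planeWave_re_eq {t : ℝ} (ht : 0 < t) (b : ℝ) :
    (∫ x in (0 : ℝ)..Real.pi, planeWave (-1 / 2 + b * Complex.I) t x).re =
      2 * (Complex.exp ((b * t : ℝ) * Complex.I) * ∫ x in (0 : ℝ)..t,
        ((Real.sqrt (coshSlope t x))⁻¹ : ℝ) *
          (Complex.exp (-Complex.I * (b * x : ℝ)) / (Real.sqrt x : ℝ))).re := by
  have hi : IntervalIntegrable (fun x : ℝ => Complex.exp ((b * t : ℝ) * Complex.I) *
      (((Real.sqrt (coshSlope t x))⁻¹ : ℝ) *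
        (Complex.exp (-Complex.I * (b * x : ℝ)) / (Real.sqrt x : ℝ))))
      MeasureTheory.volume 0 t := by
    have h : IntervalIntegrable (fun x : ℝ => x ^ (-(1 / 2) : ℝ)) MeasureTheory.volume 0 t :=
      intervalIntegral.intervalIntegrable_rpow' (by norm_num)
    have h1 : IntervalIntegrable (fun x : ℝ => ((x ^ (-(1 / 2) : ℝ) : ℝ) : ℂ))
        MeasureTheory.volume 0 t :=
      ⟨MeasureTheory.Integrable.ofReal h.1, MeasureTheory.Integrable.ofReal h.2⟩
    have hcont : ContinuousOn (fun x => (Real.sqrt (coshSlope t x))⁻¹) (Set.uIcc 0 t) := by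
      rw [Set.uIcc_of_le ht.le]
      exact (continuous_coshSlope t).sqrt.continuousOn.inv₀ fun x hx =>
        (Real.sqrt_pos.2 (coshSlope_pos ht hx)).ne'
    have h2 := h1.continuousOn_mul
      (g := fun x : ℝ => Complex.exp ((b * t : ℝ) * Complex.I) *
        (((Real.sqrt (coshSlope t x))⁻¹ : ℝ) * Complex.exp (-Complex.I * (b * x : ℝ))))
      (continuousOn_const.mul ((Complex.continuous_ofReal.comp_continuousOn hcont).mul
        (by fun_prop)))
    refine h2.congr_ae ?_
    rw [Filter.EventuallyEq, MeasureTheory.ae_restrict_iff' measurableSet_uIoc]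
    refine Eventually.of_forall fun x hx => ?_
    rw [Set.uIoc_of_le ht.le] at hx
    rw [Real.rpow_neg hx.1.le, ← Real.sqrt_eq_rpow, Complex.ofReal_inv (Real.sqrt x), div_eq_mul_inv]
    ring
  rw [integral_planeWave_re ht, ← intervalIntegral.integral_const_mul (Complex.exp _)]
  have h1 := Complex.reCLM.intervalIntegral_comp_comm hi
  simp only [Complex.reCLM_apply] at h1
  rw [← h1]
  have h2 := intervalIntegral.integral_comp_sub_left (a := 0) (b := t) (fun s =>
        Real.cos (b * s) * (Real.sqrt (2 * Real.cosh t - 2 * Real.cosh s))⁻¹) t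
  rw [sub_self, sub_zero] at h2
  rw [← h2]
  congr 1
  refine intervalIntegral.integral_congr_ae (Eventually.of_forall fun x hx => ?_)
  rw [Set.uIoc_of_le ht.le] at hx
  have hx0 := hx.1
  have hp := coshSlope_pos ht ⟨hx.1.le, hx.2⟩
  have e1 : 2 * Real.cosh t - 2 * Real.cosh (t - x) = coshSlope t x * x := by
    rw [coshSlope_of_ne t hx0.ne', div_mul_cancel₀ _ hx0.ne']
  have e2 : Complex.exp ((b * t : ℝ) * Complex.I) * (((Real.sqrt (coshSlope t x))⁻¹ : ℝ) *
        (Complex.exp (-Complex.I * (b * x : ℝ)) / (Real.sqrt x : ℝ))) =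
      (((Real.sqrt (coshSlope t x))⁻¹ * (Real.sqrt x)⁻¹ : ℝ) : ℂ) *
        Complex.exp ((b * (t - x) : ℝ) * Complex.I) := by
    rw [show ((b * (t - x) : ℝ) : ℂ) * Complex.I =
      (b * t : ℝ) * Complex.I + -Complex.I * (b * x : ℝ) by push_cast; ring, Complex.exp_add]
    push_cast
    ring
  rw [e1, e2, Real.sqrt_mul hp.le, Complex.re_ofReal_mul, Complex.exp_ofReal_mul_I_re, mul_inv]
  ring

theorem tendsto_sqrt_mul_integral_planeWave_re {t : ℝ} (ht : 0 < t) :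
    Tendsto (fun b : ℝ => Real.sqrt b *
      ((∫ x in (0 : ℝ)..Real.pi, planeWave (-1 / 2 + b * Complex.I) t x).re / Real.pi) -
      Real.sqrt (2 / (Real.pi * Real.sinh t)) * Real.cos (Real.pi / 4 - b * t)) atTop (𝓝 0) := by
  have hS := Real.sinh_pos_iff.2 ht
  have hπ := Real.pi_pos
  have h1 := (tendsto_sqrt_mul_integral_coshSlope ht).sub_const
    (2 * fresnelLimit * ((Real.sqrt (2 * Real.sinh t))⁻¹ : ℝ))
  rw [sub_self] at h1
  -- The factor `exp (i b t)` has modulus `1`, so it can multiply the error term but has no limit of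
  -- its own.
  have h2 : Tendsto (fun b : ℝ => Complex.exp ((b * t : ℝ) * Complex.I) *
      ((Real.sqrt b : ℂ) * (∫ x in (0 : ℝ)..t, ((Real.sqrt (coshSlope t x))⁻¹ : ℝ) *
          (Complex.exp (-Complex.I * (b * x : ℝ)) / (Real.sqrt x : ℝ))) -
        2 * fresnelLimit * ((Real.sqrt (2 * Real.sinh t))⁻¹ : ℝ))) atTop (𝓝 0) := by
    rw [tendsto_zero_iff_norm_tendsto_zero] at h1 ⊢
    simpa only [norm_mul, Complex.norm_exp_ofReal_mul_I, one_mul] using h1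
  have h3 := ((Complex.continuous_re.tendsto 0).comp h2).const_mul (2 / Real.pi)
  rw [Complex.zero_re, mul_zero] at h3
  refine h3.congr fun b => ?_
  have e1 : Complex.exp ((b * t : ℝ) * Complex.I) *
      (2 * fresnelLimit * ((Real.sqrt (2 * Real.sinh t))⁻¹ : ℝ)) =
      ((Real.sqrt Real.pi * (Real.sqrt (2 * Real.sinh t))⁻¹ : ℝ) : ℂ) *
        Complex.exp ((b * t - Real.pi / 4 : ℝ) * Complex.I) := by
    rw [fresnelLimit_eq, show ((b * t - Real.pi / 4 : ℝ) : ℂ) * Complex.I =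
      (b * t : ℝ) * Complex.I + -(Real.pi / 4 : ℝ) * Complex.I by push_cast; ring,
      Complex.exp_add]
    push_cast
    ring
  have e2 : Real.sqrt (2 / (Real.pi * Real.sinh t)) =
      2 / Real.pi * (Real.sqrt Real.pi * (Real.sqrt (2 * Real.sinh t))⁻¹) := by
    rw [show 2 / (Real.pi * Real.sinh t) = (2 / Real.pi) ^ 2 * (Real.pi / (2 * Real.sinh t)) by
      field_simp, Real.sqrt_mul (sq_nonneg _), Real.sqrt_sq (by positivity),
      Real.sqrt_div hπ.le, div_eq_mul_inv (Real.sqrt Real.pi)]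
  simp only [Function.comp_apply]
  rw [integral_planeWave_re_eq ht, mul_sub, e1, Complex.sub_re, Complex.re_ofReal_mul,
    Complex.exp_ofReal_mul_I_re, mul_left_comm, Complex.re_ofReal_mul, e2,
    ← Real.cos_neg (Real.pi / 4 - b * t), neg_sub]
  ring

theorem tendsto_of_isRadialSolution_one {f f' : ℝ → ℝ → ℝ}
    (hf : ∀ Λ, 0 < Λ → IsRadialSolution 1 Λ (f Λ) (f' Λ) 1) {t : ℝ} (ht : 0 < t) :
    Tendsto (fun Λ => Real.sqrt (Real.sqrt Λ) * f Λ t - Real.sqrt (2 / (Real.pi * Real.sinh t)) *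
      Real.cos (Real.pi / 4 - Real.sqrt Λ * t)) atTop (𝓝 0) := by
  have h1 := (tendsto_sqrt_mul_integral_planeWave_re ht).comp (tendsto_sqrt_sub_atTop (1 / 4))
  set A := Real.sqrt (2 / (Real.pi * Real.sinh t)) with hA
  -- The factor that converts `√b` into `Λ ^ (1 / 4)`, where `b = √(Λ - 1 / 4)`.
  have hr : Tendsto (fun Λ : ℝ => Real.sqrt (Real.sqrt Λ / Real.sqrt (Λ - 1 / 4))) atTop
      (𝓝 1) := by
    simpa using (tendsto_sqrt_div_sqrt (1 / 4)).sqrt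
  have hr0 : Tendsto (fun Λ : ℝ => A * (Real.sqrt (Real.sqrt Λ / Real.sqrt (Λ - 1 / 4)) - 1)) atTop
      (𝓝 0) := by
    simpa using (hr.sub_const 1).const_mul A
  have h2 := hr0.zero_mul_isBoundedUnder_le
    (g := fun Λ : ℝ => Real.cos (Real.pi / 4 - Real.sqrt (Λ - 1 / 4) * t)) (isBoundedUnder_of
      ⟨1, fun x => by simpa using Real.abs_cos_le_one _⟩)
  have h3 := (tendsto_cos_sub_cos (1 / 4) (Real.pi / 4) t).const_mul A
  have h4 := ((hr.mul h1).add h2).add h3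
  simp only [mul_zero, add_zero] at h4
  refine h4.congr' ?_
  filter_upwards [eventually_gt_atTop (1 / 4)] with Λ hΛ
  have hb := Real.sqrt_pos.2 (sub_pos.2 hΛ)
  obtain ⟨g', hg⟩ := isRadialSolution_one (Real.sqrt (Λ - 1 / 4))
  rw [Real.sq_sqrt (sub_pos.2 hΛ).le, add_sub_cancel] at hg
  rw [(hf Λ (by linarith)).eq hg le_rfl (by linarith) ht]
  have hbb := (Real.sqrt_pos.2 hb).ne'
  simp only [Function.comp_apply]
  rw [Real.sqrt_div (Real.sqrt_nonneg _)]
  generalize Real.sqrt (Real.sqrt (Λ - 1 / 4)) = d at hbb ⊢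
  field_simp
  ring

/-! ### Return to curvature `-1/ρ²` and conclusion. -/

theorem isLittleO_one_div_of_tendsto {g : ℝ → ℂ} {h s : ℝ → ℝ} (hg : ∀ᶠ x in atTop, g x = h x)
    (hs : ∀ᶠ x in atTop, 0 < s x) (hlim : Tendsto (fun x => s x * h x) atTop (𝓝 0)) :
    g =o[atTop] fun x => 1 / s x := by
  have h1 : h =o[atTop] fun x => 1 / s x := by
    refine (isLittleO_iff_tendsto' ?_).2 (hlim.congr fun x => ?_)
    · filter_upwards [hs] with x hx hx0
      exact absurd hx0 (one_div_pos.2 hx).ne'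
    · rw [div_div_eq_mul_div, div_one, mul_comm]
  refine IsLittleO.of_norm_left (h1.norm_left.congr' ?_ EventuallyEq.rfl)
  filter_upwards [hg] with x hx
  rw [hx, Complex.norm_real]

theorem mainTheorem10 (k : ℕ) (ρ : ℝ) (hρ : 0 < ρ)
    (φ : ℝ → ℝ → ℂ) (hφ : ∀ lam : ℝ, IsRadialEigenfunction k ρ (lam : ℂ) (φ lam))
    (r : ℝ) (hr : 0 < r) :
    (k = 1 →
      (fun lam : ℝ => φ lam r -
          ((Real.sqrt (2 / (Real.pi * ρ * Real.sinh (r / ρ))) *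
            (Real.cos (Real.pi / 4 - r * Real.sqrt lam) / lam ^ (1 / 4 : ℝ)) : ℝ) : ℂ))
        =o[atTop] (fun lam : ℝ => 1 / lam ^ (1 / 4 : ℝ))) ∧
    (k = 2 →
      (∀ lam : ℝ, 1 / ρ ^ 2 < lam →
        φ lam r =
          ((Real.sin (Real.sqrt (lam * ρ ^ 2 - 1) * r / ρ) /
            (Real.sqrt (lam * ρ ^ 2 - 1) * Real.sinh (r / ρ)) : ℝ) : ℂ)) ∧
      (fun lam : ℝ => φ lam r -
          ((1 / (ρ * Real.sinh (r / ρ)) *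
            (Real.sin (r * Real.sqrt lam) / Real.sqrt lam) : ℝ) : ℂ))
        =o[atTop] (fun lam : ℝ => 1 / Real.sqrt lam)) ∧
    (3 ≤ k →
      (fun lam : ℝ => φ lam r) =o[atTop] (fun lam : ℝ => 1 / Real.sqrt lam)) ∧
    (k = 4 →
      (fun lam : ℝ => φ lam r -
          ((-((Real.sqrt 3 / (ρ * Real.sinh (r / ρ))) ^ 2) *
            (Real.cos (r * Real.sqrt lam) / lam) : ℝ) : ℂ))
        =o[atTop] (fun lam : ℝ => 1 / lam)) := by
  have ht : 0 < r / ρ := div_pos hr hρ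
  have hS : 0 < Real.sinh (r / ρ) := Real.sinh_pos_iff.2 ht
  have hρt : ∀ x, x * ρ * (r / ρ) = x * r := fun x => by field_simp
  have hscale : Tendsto (fun lam : ℝ => lam * ρ ^ 2) atTop atTop :=
    tendsto_id.atTop_mul_const (by positivity)
  -- The family is reindexed by `Λ = lam * ρ ^ 2`. The powers `Λ ^ (1 / 4)`, `√Λ` and `Λ` then
  -- produce factors `√ρ`, `ρ` and `ρ ^ 2`, which are divided out below.
  have hsol : ∀ Λ, 0 < Λ → IsRadialSolution k Λ (fun t => (φ (Λ / ρ ^ 2) (ρ * t)).re)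
      (fun t => ρ * (deriv (φ (Λ / ρ ^ 2)) (ρ * t)).re) 1 := fun Λ _ => by
    have h := (hφ (Λ / ρ ^ 2)).isRadialSolution hρ Complex.reCLM
    rwa [div_mul_cancel₀ _ (pow_ne_zero 2 hρ.ne')] at h
  have hval : ∀ lam : ℝ, (φ (lam * ρ ^ 2 / ρ ^ 2) (ρ * (r / ρ))).re = (φ lam r).re := fun lam => by
    rw [mul_div_cancel_right₀ _ (pow_ne_zero 2 hρ.ne'), mul_div_cancel₀ r hρ.ne']
  have hsqrt : ∀ lam : ℝ, 0 < lam → Real.sqrt (lam * ρ ^ 2) = Real.sqrt lam * ρ := fun lam h => by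
    rw [Real.sqrt_mul h.le, Real.sqrt_sq hρ.le]
  have hreal : 1 ≤ k → ∀ lam : ℝ, 0 < lam → φ lam r = ((φ lam r).re : ℂ) := fun hk lam hlam =>
    (hφ lam).eq_ofReal hρ hk hlam hr
  refine ⟨?_, ?_, ?_, ?_⟩
  · rintro rfl
    refine isLittleO_one_div_of_tendsto (h := fun lam => (φ lam r).re -
      Real.sqrt (2 / (Real.pi * ρ * Real.sinh (r / ρ))) *
        (Real.cos (Real.pi / 4 - r * Real.sqrt lam) / lam ^ (1 / 4 : ℝ))) ?_ ?_ ?_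
    · filter_upwards [eventually_gt_atTop 0] with lam hlam
      rw [Complex.ofReal_sub, ← hreal le_rfl lam hlam]
    · filter_upwards [eventually_gt_atTop 0] with lam hlam
      positivity
    · have h := ((tendsto_of_isRadialSolution_one hsol ht).comp hscale).div_const (Real.sqrt ρ)
      rw [zero_div] at h
      refine h.congr' ?_
      filter_upwards [eventually_gt_atTop 0] with lam hlam
      have hρs := Real.sqrt_pos.2 hρ
      have e1 : Real.sqrt (Real.sqrt lam) = lam ^ (1 / 4 : ℝ) := by
        rw [Real.sqrt_eq_rpow, Real.sqrt_eq_rpow, ← Real.rpow_mul hlam.le]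
        norm_num
      have e2 : Real.sqrt (2 / (Real.pi * Real.sinh (r / ρ))) =
          Real.sqrt (2 / (Real.pi * ρ * Real.sinh (r / ρ))) * Real.sqrt ρ := by
        rw [← Real.sqrt_mul (by positivity)]
        congr 1
        field_simp
      have hq : lam ^ (1 / 4 : ℝ) ≠ 0 := (Real.rpow_pos_of_pos hlam _).ne'
      simp only [Function.comp_apply]
      rw [hval, hsqrt lam hlam, hρt, Real.sqrt_mul (Real.sqrt_nonneg _), e1, e2,
        mul_comm (Real.sqrt lam) r]
      field_simp
  · rintro rfl
    refine ⟨fun lam hlam => ?_, ?_⟩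
    · have hlam0 : 0 < lam := lt_trans (by positivity) hlam
      have hΛ : 1 < lam * ρ ^ 2 := (div_lt_iff₀ (by positivity)).1 hlam
      have h := (hsol (lam * ρ ^ 2) (by positivity)).eq_sin_div hΛ ht
      rw [hval, ← mul_div_assoc] at h
      rw [hreal one_le_two lam hlam0, h]
    · refine isLittleO_one_div_of_tendsto (h := fun lam => (φ lam r).re -
        1 / (ρ * Real.sinh (r / ρ)) * (Real.sin (r * Real.sqrt lam) / Real.sqrt lam)) ?_ ?_ ?_
      · filter_upwards [eventually_gt_atTop 0] with lam hlam
        rw [Complex.ofReal_sub, ← hreal one_le_two lam hlam]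
      · filter_upwards [eventually_gt_atTop 0] with lam hlam
        positivity
      · have h := ((tendsto_of_isRadialSolution_two hsol ht).comp hscale).div_const ρ
        rw [zero_div] at h
        refine h.congr' ?_
        filter_upwards [eventually_gt_atTop 0] with lam hlam
        have hq := Real.sqrt_pos.2 hlam
        simp only [Function.comp_apply]
        rw [hval, hsqrt lam hlam, hρt, mul_comm (Real.sqrt lam) r]
        field_simp
  · intro hk
    refine isLittleO_one_div_of_tendsto (h := fun lam => (φ lam r).re) ?_ ?_ ?_
    · filter_upwards [eventually_gt_atTop 0] with lam hlam using hreal (by omega) lam hlam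
    · filter_upwards [eventually_gt_atTop 0] with lam hlam
      positivity
    · have h := ((tendsto_sqrt_mul_of_isRadialSolution hk hsol ht).comp hscale).div_const ρ
      rw [zero_div] at h
      refine h.congr' ?_
      filter_upwards [eventually_gt_atTop 0] with lam hlam
      simp only [Function.comp_apply]
      rw [hval, hsqrt lam hlam]
      field_simp
  · rintro rfl
    refine isLittleO_one_div_of_tendsto (h := fun lam => (φ lam r).re -
      -((Real.sqrt 3 / (ρ * Real.sinh (r / ρ))) ^ 2) * (Real.cos (r * Real.sqrt lam) / lam))
      ?_ (eventually_gt_atTop 0) ?_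
    · filter_upwards [eventually_gt_atTop 0] with lam hlam
      rw [Complex.ofReal_sub, ← hreal (by norm_num) lam hlam]
    · have h := ((tendsto_of_isRadialSolution_four hsol ht).comp hscale).div_const (ρ ^ 2)
      rw [zero_div] at h
      refine h.congr' ?_
      filter_upwards [eventually_gt_atTop 0] with lam hlam
      simp only [Function.comp_apply]
      rw [hval, hsqrt lam hlam, hρt, mul_comm (Real.sqrt lam) r, div_pow, Real.sq_sqrt zero_le_three]
      field_simp
      ring
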